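/- Let $n \ge 8$ and $s$ be integers with $s^2 \equiv 1 \pmod n$ and $s \not\equiv \pm 1 \pmod n$, and let $G_{n,s} = C_n \rtimes_s C_2 = \langle x, y \mid x^2 = y^n = 1,\ yx = xy^s \rangle$. A sequence over a finite group $G$ is a finite unordered sequence of elements of $G$, repetition allowed. It is a product-one sequence if its terms can be ordered so that their product is $1$. It is product-one free if it has no non-empty product-one subsequence. Let $\mathsf d(G)$ be the maximal length of a product-one free sequence over $G$, and let $\mathsf E(G)$, $\mathsf s(G)$ and $\eta(G)$ be the smallest $\ell > 0$ such that every sequence over $G$ of length at least $\ell$ has a product-one subsequence of length $|G|$, of length $\exp(G)$, and of length in $[1, \exp(G)]$, respectively. If $n$ is odd, there are unique coprime integers $n_1, n_2 \ge 3$ with $n = n_1 n_2$, $s \equiv -1 \pmod{n_1}$ and $s \equiv 1 \pmod{n_2}$; in this case suppose additionally that $n_1 > 3$. Then $$\mathsf E(G_{n,s}) = 3n \qquad\text{and}\qquad \mathsf s(G_{n,s}) = \begin{cases} 2n & \text{if } n \text{ is even},\\ 3n & \text{if } n \text{ is odd}.\end{cases}$$ Moreover, the conjectures of Gao and of Zhuang–Gao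 hold for $G_{n,s}$, that is, $$\mathsf s(G_{n,s}) = \eta(G_{n,s}) + \exp(G_{n,s}) - 1 \qquad\text{and}\qquad \mathsf E(G_{n,s}) = \mathsf d(G_{n,s}) + |G_{n,s}|.$$ -/

import Mathlib

namespace ZeroSum

/-- The two generators in the presentation of `C_n ⋊_s C_2`. -/
inductive Gen : Type
  | x : Gen
  | y : Gen

/-- The relators `x ^ 2`, `y ^ n`, and `(y x) (x y ^ s)⁻¹`. -/
def rels (n : ℕ) (s : ℤ) : Set (FreeGroup Gen) :=
  {FreeGroup.of Gen.x ^ 2,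
   FreeGroup.of Gen.y ^ n,
   (FreeGroup.of Gen.y * FreeGroup.of Gen.x) *
     (FreeGroup.of Gen.x * FreeGroup.of Gen.y ^ s)⁻¹}

/-- The group `G_{n,s} = C_n ⋊_s C_2 = ⟨x, y ∣ x² = yⁿ = 1, y x = x yˢ⟩`. -/
abbrev Gns (n : ℕ) (s : ℤ) : Type := PresentedGroup (rels n s)

/-- A (finite, unordered) sequence over `G` is a `Multiset G`; its length is `Multiset.card` and
subsequences are given by `≤`. The set of products `π(S)` consists of the products of the terms
of `S`, taken in all possible orders. -/
def products {G : Type*} [Group G] (S : Multiset G) : Set G :=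
  {g | ∃ l : List G, (l : Multiset G) = S ∧ l.prod = g}

/-- `S` is a product-one sequence. -/
def IsProductOne {G : Type*} [Group G] (S : Multiset G) : Prop :=
  (1 : G) ∈ products S

/-- `S` has a product-one subsequence of length `k`. -/
def HasProductOneSub {G : Type*} [Group G] (k : ℕ) (S : Multiset G) : Prop :=
  ∃ T : Multiset G, T ≤ S ∧ Multiset.card T = k ∧ IsProductOne T

/-- `S` is product-one free: it has no non-empty product-one subsequence. -/
def IsProductOneFree {G : Type*} [Group G] (S : Multiset G) : Prop :=
  ∀ T : Multiset G, T ≤ S → 1 ≤ Multiset.card T → ¬ IsProductOne T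

/-- `S` has a short product-one subsequence, i.e. one of length between `1` and `exp G`. -/
def HasShortProductOneSub {G : Type*} [Group G] (S : Multiset G) : Prop :=
  ∃ T : Multiset G, T ≤ S ∧ 1 ≤ Multiset.card T ∧ Multiset.card T ≤ Monoid.exponent G ∧
    IsProductOne T

/-- The small Davenport constant `d(G)`: the maximal length of a product-one free sequence. -/
noncomputable def smallDavenport (G : Type*) [Group G] : ℕ :=
  sSup {k | ∃ S : Multiset G, Multiset.card S = k ∧ IsProductOneFree S}

/-- The Gao constant `E(G)`: the smallest `ℓ > 0` such that every sequence of length at least `ℓ`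
has a product-one subsequence of length `|G|`. -/
noncomputable def gaoConstant (G : Type*) [Group G] : ℕ :=
  sInf {l | 0 < l ∧ ∀ S : Multiset G, l ≤ Multiset.card S → HasProductOneSub (Nat.card G) S}

/-- The constant `η(G)`: the smallest `ℓ > 0` such that every sequence of length at least `ℓ`
has a short product-one subsequence. -/
noncomputable def etaConstant (G : Type*) [Group G] : ℕ :=
  sInf {l | 0 < l ∧ ∀ S : Multiset G, l ≤ Multiset.card S → HasShortProductOneSub S}

/-- The Erdős–Ginzburg–Ziv constant `s(G)`: the smallest `ℓ > 0` such that every sequence of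
length at least `ℓ` has a product-one subsequence of length `exp G`. -/
noncomputable def egzConstant (G : Type*) [Group G] : ℕ :=
  sInf {l | 0 < l ∧ ∀ S : Multiset G, l ≤ Multiset.card S →
    HasProductOneSub (Monoid.exponent G) S}

/-- For odd `n`, the factorization `n = n₁ n₂` attached to `s`: the factors are coprime and at
least `3`, with `s ≡ -1 (mod n₁)` and `s ≡ 1 (mod n₂)`. -/
def IsFactorization (n : ℕ) (s : ℤ) (n₁ n₂ : ℕ) : Prop :=
  n = n₁ * n₂ ∧ Nat.Coprime n₁ n₂ ∧ 3 ≤ n₁ ∧ 3 ≤ n₂ ∧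
    s ≡ -1 [ZMOD (n₁ : ℤ)] ∧ s ≡ 1 [ZMOD (n₂ : ℤ)]

end ZeroSum

/-! Every element of the group is `y ^ a` or `x * y ^ a` with `a` in a cyclic group `N` of order
`n`, and conjugation by `x` acts on `N` as an involution `σ`. The sequence of `x` and `n - 1` copies
of `y` is product-one free of length `n`. Padding it with `e - 1` copies of `1` shows that `n + e -
1` terms need not contain a product-one subsequence of length `e`. All four constants follow once
these bounds are matched (`constants_eq_of_isProductOneFree`): for even `n`, where the exponent is
`n`, any `2 * n` terms must contain `n` with product one; for odd `n`, where the exponent is `2 *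
n`, any `3 * n` terms must contain `2 * n` with product one.

Even `n` (`Frame.exists_ach_card`): pair up terms of equal type (inside or outside `N`) and equal
parity. Products of pairs lie in the subgroup of index 2, of order `M = n / 2`, and
Erdős–Ginzburg–Ziv (EGZ) finishes if there are `2 * M - 1` pairs. Otherwise one term of each of the
four classes is left over, with `2 * M - 2` pairs. By the inverse form of EGZ
(`exists_dvd_sum_sub`), the sums of `M` pairs then miss only zero, so all orderings of the leftover
terms with product in the index 2 subgroup must have the same product. Exchanging leftover terms for
paired ones forces all pair products into the proper subgroup fixed by `σ`, where EGZ needs fewer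
pairs.

Odd `n` (`Frame.exists_ach_two_mul`): write `N = ZMod m × ZMod l` with `σ = (-1, 1)`. If many terms
lie outside `N`, pairs with equal first coordinate can be ordered so as to have product in `0 × ZMod
l`, and EGZ applies to the pairs. If few do, take a block of `2 * l` terms, some of them outside
`N`, with second coordinates summing to zero, and add `2 * m - 2` blocks of `l` terms of `N` with
the same property. Enclosing a term `a` between two outside terms changes the first coordinate of
the product by `-2 * a.1`; the blocks are chosen so that such changes reach all of `ZMod m`. When
the set of changes stops growing, nearly all terms of `N` lie in a proper subgroup, and EGZ in that
subgroup finishes. -/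

namespace ZeroSum

/-! ### Sub-multisets and pairings. -/

section Multisets

variable {α β : Type*}

theorem exists_le_map_eq {f : α → β} {S : Multiset α} {T : Multiset β} (h : T ≤ S.map f) :
    ∃ S' ≤ S, S'.map f = T := by
  classical
  induction S using Multiset.induction generalizing T with
  | empty =>
    refine ⟨0, le_rfl, ?_⟩
    simpa using h.antisymm (Multiset.zero_le _) |>.symm
  | cons a S ih =>
    rw [Multiset.map_cons] at h
    by_cases ha : f a ∈ T
    · obtain ⟨T', rfl⟩ := Multiset.exists_cons_of_mem ha
      obtain ⟨S', hS', rfl⟩ := ih ((Multiset.cons_le_cons_iff _).1 h)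
      exact ⟨a ::ₘ S', (Multiset.cons_le_cons_iff _).2 hS', by simp⟩
    · obtain ⟨S', hS', rfl⟩ := ih ((Multiset.le_cons_of_notMem ha).1 h)
      exact ⟨S', hS'.trans (Multiset.le_cons_self _ _), rfl⟩

theorem le_cons_cases {a : α} {S T : Multiset α} (h : T ≤ a ::ₘ S) :
    T ≤ S ∨ ∃ T' ≤ S, T = a ::ₘ T' := by
  classical
  by_cases ha : a ∈ T
  · obtain ⟨T', rfl⟩ := Multiset.exists_cons_of_mem ha
    exact Or.inr ⟨T', (Multiset.cons_le_cons_iff _).1 h, rfl⟩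
  · exact Or.inl ((Multiset.le_cons_of_notMem ha).1 h)

theorem exists_le_card {S : Multiset α} {k : ℕ} (h : k ≤ Multiset.card S) :
    ∃ T ≤ S, Multiset.card T = k := by
  induction S using Multiset.induction generalizing k with
  | empty => exact ⟨0, le_rfl, by simp at h; simp [h]⟩
  | cons a S ih =>
    rcases Nat.eq_zero_or_pos k with rfl | hk
    · exact ⟨0, Multiset.zero_le _, rfl⟩
    · obtain ⟨T, hT, hc⟩ := ih (k := k - 1) (by simp at h; omega)
      exact ⟨a ::ₘ T, (Multiset.cons_le_cons_iff _).2 hT, by simp; omega⟩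

/-- The multiset of all components of a multiset of pairs. -/
def flatten (Q : Multiset (α × α)) : Multiset α := Q.map Prod.fst + Q.map Prod.snd

@[simp] theorem flatten_zero : flatten (0 : Multiset (α × α)) = 0 := rfl

theorem flatten_add (Q R : Multiset (α × α)) : flatten (Q + R) = flatten Q + flatten R := by
  simp only [flatten, Multiset.map_add]; abel

theorem flatten_cons (q : α × α) (Q : Multiset (α × α)) :
    flatten (q ::ₘ Q) = {q.1, q.2} + flatten Q := by
  simp only [flatten, Multiset.map_cons]
  simp only [← Multiset.singleton_add, Multiset.insert_eq_cons]
  abel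

@[simp] theorem card_flatten (Q : Multiset (α × α)) :
    Multiset.card (flatten Q) = 2 * Multiset.card Q := by
  simp [flatten]; omega

theorem flatten_mono {Q R : Multiset (α × α)} (h : Q ≤ R) : flatten Q ≤ flatten R :=
  add_le_add (Multiset.map_le_map h) (Multiset.map_le_map h)

theorem fst_mem_flatten {Q : Multiset (α × α)} {q : α × α} (h : q ∈ Q) : q.1 ∈ flatten Q :=
  Multiset.mem_add.2 (Or.inl (Multiset.mem_map_of_mem _ h))

theorem snd_mem_flatten {Q : Multiset (α × α)} {q : α × α} (h : q ∈ Q) : q.2 ∈ flatten Q :=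
  Multiset.mem_add.2 (Or.inr (Multiset.mem_map_of_mem _ h))

theorem flatten_map (f : α → β) (Q : Multiset (α × α)) :
    flatten (Q.map (Prod.map f f)) = (flatten Q).map f := by
  simp [flatten]

/-- Pair up the terms of a multiset inside the classes of `κ`, up to one leftover per class. -/
theorem exists_pairing (κ : α → β) (S : Multiset α) :
    ∃ (Q : Multiset (α × α)) (L : Multiset α), flatten Q + L = S ∧
      (∀ q ∈ Q, κ q.1 = κ q.2) ∧ (L.map κ).Nodup := by
  classical
  induction S using Multiset.induction with
  | empty => exact ⟨0, 0, by simp⟩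
  | cons a S ih =>
    obtain ⟨Q, L, rfl, hQ, hL⟩ := ih
    by_cases h : κ a ∈ L.map κ
    · obtain ⟨l, hl, hla⟩ := Multiset.mem_map.1 h
      obtain ⟨L', rfl⟩ := Multiset.exists_cons_of_mem hl
      refine ⟨(a, l) ::ₘ Q, L', ?_, ?_, ?_⟩
      · rw [flatten_cons]
        simp only [Multiset.insert_eq_cons, ← Multiset.singleton_add]; abel
      · intro q hq
        rcases Multiset.mem_cons.1 hq with rfl | hq
        · exact hla.symm
        · exact hQ q hq
      · rw [Multiset.map_cons] at hL
        exact (Multiset.nodup_cons.1 hL).2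
    · refine ⟨Q, a ::ₘ L, by simp, hQ, ?_⟩
      rw [Multiset.map_cons]
      exact Multiset.nodup_cons.2 ⟨h, hL⟩

theorem exists_pairing_card [Finite β] (κ : α → β) (S : Multiset α) :
    ∃ Q : Multiset (α × α), flatten Q ≤ S ∧ (∀ q ∈ Q, κ q.1 = κ q.2) ∧
      Multiset.card S ≤ 2 * Multiset.card Q + Nat.card β := by
  have := Fintype.ofFinite β
  obtain ⟨Q, L, rfl, hQ, hL⟩ := exists_pairing κ S
  refine ⟨Q, Multiset.le_add_right _ _, hQ, ?_⟩
  classical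
  have h1 : Multiset.card (L.map κ) ≤ Fintype.card β := by
    rw [← Multiset.toFinset_card_of_nodup hL]
    exact Finset.card_le_univ _
  rw [Multiset.card_map] at h1
  simp only [Multiset.card_add, card_flatten, Nat.card_eq_fintype_card]
  omega

/-- A multiset of `2 k` elements with all multiplicities at most `k` splits into pairs of
distinct elements. -/
theorem exists_pairing_ne [DecidableEq α] (k : ℕ) (S : Multiset α)
    (hS : Multiset.card S = 2 * k) (hc : ∀ a, S.count a ≤ k) :
    ∃ Q : Multiset (α × α), flatten Q = S ∧ ∀ q ∈ Q, q.1 ≠ q.2 := by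
  induction k generalizing S with
  | zero => exact ⟨0, by simpa using (Multiset.card_eq_zero.1 hS).symm, by simp⟩
  | succ k ih =>
    have hne : S.toFinset.Nonempty := by
      rw [Multiset.toFinset_nonempty]
      rintro rfl
      simp at hS
    obtain ⟨a, ha, hmax⟩ := S.toFinset.exists_max_image (fun x => S.count x) hne
    obtain ⟨b, hb, hba⟩ : ∃ b ∈ S, b ≠ a := by
      by_contra! h
      have := hc a
      rw [Multiset.count_eq_card.2 fun x hx => (h x hx).symm] at this
      omega
    rw [Multiset.mem_toFinset] at ha
    obtain ⟨S1, rfl⟩ := Multiset.exists_cons_of_mem ha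
    obtain ⟨S2, rfl⟩ := Multiset.exists_cons_of_mem ((Multiset.mem_cons.1 hb).resolve_left hba)
    obtain ⟨Q, rfl, hQ⟩ := ih S2 (by simp at hS; omega) (by
      intro c
      have hcc := hc c
      -- If `c` still had multiplicity above `k`, so would `a`, whose multiplicity is maximal;
      -- together with `b` this makes at least `2 * k + 3` terms.
      by_contra! hlt
      have hca : c ≠ a := by rintro rfl; simp [hba.symm] at hcc; omega
      have hcb : c ≠ b := by rintro rfl; simp [hba] at hcc; omega
      have h2 : c ∈ S2 := Multiset.count_pos.1 (by omega)
      have hm := hmax c (by simp [h2])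
      have hsum := Multiset.toFinset_sum_count_eq (a ::ₘ b ::ₘ S2)
      have hsub : ({a, b, c} : Finset α) ⊆ (a ::ₘ b ::ₘ S2).toFinset := by
        intro x hx
        simp at hx
        rcases hx with rfl | rfl | rfl <;> simp [h2]
      have hle := Finset.sum_le_sum_of_subset (f := fun x => (a ::ₘ b ::ₘ S2).count x) hsub
      rw [hsum, Finset.sum_insert (by simp [hba.symm, hca.symm]),
        Finset.sum_insert (by simp [hcb.symm]), Finset.sum_singleton] at hle
      have hb1 : 1 ≤ (a ::ₘ b ::ₘ S2).count b := Multiset.count_pos.2 (by simp)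
      have hc1 : (a ::ₘ b ::ₘ S2).count c = S2.count c := by simp [hca, hcb]
      rw [hc1] at hm
      omega)
    refine ⟨(a, b) ::ₘ Q, by rw [flatten_cons]; simp, ?_⟩
    intro q hq
    rcases Multiset.mem_cons.1 hq with rfl | hq
    · exact hba.symm
    · exact hQ q hq

end Multisets

/-! ### Subset sums and their periods. -/

section SubsetSums

variable {H : Type*} [AddCommGroup H]

open Classical in
/-- The set of all sums of sub-multisets. -/
noncomputable def subsetSums (D : Multiset H) : Finset H :=
  (D.powerset.map Multiset.sum).toFinset

theorem mem_subsetSums {D : Multiset H} {h : H} :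
    h ∈ subsetSums D ↔ ∃ T ≤ D, T.sum = h := by
  simp [subsetSums]

theorem subsetSums_mono {D E : Multiset H} (h : D ≤ E) : subsetSums D ⊆ subsetSums E := by
  intro x hx
  obtain ⟨T, hT, rfl⟩ := mem_subsetSums.1 hx
  exact mem_subsetSums.2 ⟨T, hT.trans h, rfl⟩

theorem zero_mem_subsetSums (D : Multiset H) : 0 ∈ subsetSums D :=
  mem_subsetSums.2 ⟨0, Multiset.zero_le _, rfl⟩

theorem mem_subsetSums_map {β : Type*} {S : Multiset β} {f : β → H} {h : H} :
    h ∈ subsetSums (S.map f) ↔ ∃ T ≤ S, (T.map f).sum = h := by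
  rw [mem_subsetSums]
  constructor
  · rintro ⟨T, hT, rfl⟩
    obtain ⟨S', hS', rfl⟩ := exists_le_map_eq hT
    exact ⟨S', hS', rfl⟩
  · rintro ⟨T, hT, rfl⟩
    exact ⟨_, Multiset.map_le_map hT, rfl⟩

theorem subsetSums_cons [DecidableEq H] (d : H) (D : Multiset H) :
    subsetSums (d ::ₘ D) = subsetSums D ∪ (subsetSums D).image (· + d) := by
  ext x
  simp only [Finset.mem_union, Finset.mem_image, mem_subsetSums]
  constructor
  · rintro ⟨T, hT, rfl⟩
    rcases le_cons_cases hT with h | ⟨T', hT', rfl⟩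
    · exact Or.inl ⟨T, h, rfl⟩
    · exact Or.inr ⟨T'.sum, ⟨T', hT', rfl⟩, by simp [add_comm]⟩
  · rintro (⟨T, hT, rfl⟩ | ⟨_, ⟨T, hT, rfl⟩, rfl⟩)
    · exact ⟨T, hT.trans (Multiset.le_cons_self _ _), rfl⟩
    · exact ⟨d ::ₘ T, (Multiset.cons_le_cons_iff _).2 hT, by simp [add_comm]⟩

/-- The subgroup of periods of a set. -/
def periods (X : Finset H) : AddSubgroup H where
  carrier := {d | ∀ x, x + d ∈ X ↔ x ∈ X}
  zero_mem' := by simp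
  add_mem' := by
    intro a b ha hb x
    rw [← add_assoc, hb, ha]
  neg_mem' := by
    intro a ha x
    rw [← ha (x + -a)]
    simp

theorem mem_periods {X : Finset H} {d : H} : d ∈ periods X ↔ ∀ x, x + d ∈ X ↔ x ∈ X := Iff.rfl

/-- If the translate by `d` adds nothing, it lies in `X` and equals it by finiteness, so `d` is a
period. -/
theorem card_lt_card_union_image [DecidableEq H] {X : Finset H} {d : H} (hd : d ∉ periods X) :
    X.card < (X ∪ X.image (· + d)).card := by
  refine Finset.card_lt_card (Finset.ssubset_iff_subset_ne.2 ⟨Finset.subset_union_left, ?_⟩)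
  intro h
  apply hd
  have hsub : X.image (· + d) ⊆ X := by
    exact Finset.subset_union_right.trans h.ge
  have heq : X.image (· + d) = X :=
    Finset.eq_of_subset_of_card_le hsub
      (Finset.card_image_of_injective _ (add_left_injective d)).ge
  intro x
  constructor
  · intro hx
    rw [← heq] at hx
    obtain ⟨y, hy, hyx⟩ := Finset.mem_image.1 hx
    rwa [← add_right_cancel hyx]
  · intro hx
    exact hsub (Finset.mem_image_of_mem _ hx)

/-- The whole coset of `y` modulo the periods avoids `X`. -/
theorem card_periods_add_card_le [Finite H] {X : Finset H} {y : H} (hy : y ∉ X) :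
    Nat.card (periods X) + X.card ≤ Nat.card H := by
  classical
  have := Fintype.ofFinite H
  have h1 : Nat.card (periods X) ≤ Xᶜ.card := by
    rw [← Nat.card_eq_finsetCard]
    refine Nat.card_le_card_of_injective
      (fun k : periods X => (⟨y + k, ?_⟩ : (Xᶜ : Finset H))) ?_
    · have := (mem_periods.1 k.2 y).not.2 hy
      simpa using this
    · intro a b hab
      simpa using hab
  rw [Nat.card_eq_fintype_card (α := H)]
  have := Finset.card_compl_add_card X
  omega

theorem periods_subsetSums_le_cons (d : H) (D : Multiset H) :
    periods (subsetSums D) ≤ periods (subsetSums (d ::ₘ D)) := by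
  classical
  intro e he x
  have hx : ∀ y, (∃ z, z ∈ subsetSums D ∧ z + d = y) ↔ y - d ∈ subsetSums D := fun y =>
    ⟨by rintro ⟨z, hz, rfl⟩; simpa using hz, fun h => ⟨_, h, by simp⟩⟩
  simp only [subsetSums_cons, Finset.mem_union, Finset.mem_image, hx]
  rw [mem_periods.1 he x, show x + e - d = x - d + e by abel, mem_periods.1 he (x - d)]

theorem card_subsetSums_lt_cons {d : H} {D : Multiset H} (hd : d ∉ periods (subsetSums D)) :
    (subsetSums D).card < (subsetSums (d ::ₘ D)).card := by
  classical
  rw [subsetSums_cons]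
  exact card_lt_card_union_image hd

open Classical in
-- Periods only grow as terms are added, so a term outside `K` is no period at the moment it is
-- added and strictly enlarges the set of sums, which starts as `{0}`.
theorem card_filter_lt_card_subsetSums (K : AddSubgroup H) (D : Multiset H)
    (h : periods (subsetSums D) ≤ K) :
    Multiset.card (D.filter (· ∉ K)) < (subsetSums D).card := by
  induction D using Multiset.induction with
  | empty => simpa using ⟨0, zero_mem_subsetSums _⟩
  | cons d D ih =>
    have h' := (periods_subsetSums_le_cons d D).trans h
    have := ih h'
    by_cases hd : d ∈ K
    · rw [Multiset.filter_cons_of_neg (p := (· ∉ K)) _ (by simpa using hd)]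
      exact this.trans_le (Finset.card_le_card (subsetSums_mono (Multiset.le_cons_self _ _)))
    · rw [Multiset.filter_cons_of_pos (p := (· ∉ K)) _ hd, Multiset.card_cons]
      have := card_subsetSums_lt_cons (fun hx => hd (h' hx))
      omega

/-- Choosing one element out of each pair. -/
theorem exists_choice_of_mem_subsetSums {α : Type*} {φ : α → H} {Q : Multiset (α × α)} {t : H}
    (h : t ∈ subsetSums (Q.map fun q => φ q.2 - φ q.1)) :
    ∃ T ≤ flatten Q, Multiset.card T = Multiset.card Q ∧
      (T.map φ).sum = (Q.map fun q => φ q.1).sum + t := by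
  obtain ⟨P, hP, rfl⟩ := mem_subsetSums_map.1 h
  obtain ⟨R, rfl⟩ := Multiset.le_iff_exists_add.1 hP
  refine ⟨P.map Prod.snd + R.map Prod.fst, ?_, by simp, ?_⟩
  · rw [flatten]
    simp only [Multiset.map_add]
    rw [add_comm]
    exact add_le_add (Multiset.le_add_left _ _) (Multiset.le_add_right _ _)
  · simp only [Multiset.map_add, Multiset.map_map, Multiset.sum_add, Multiset.sum_map_sub,
      Function.comp_def]
    abel

end SubsetSums

/-! ### Erdős–Ginzburg–Ziv in a cyclic group. -/

section EGZ

/-- EGZ is applied repeatedly, each time removing a zero-sum block of length `Nat.card K`. Only the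
last block needs the surplus of `Nat.card K - 1` terms. -/
theorem exists_zero_sum_of_addSubgroup {N β : Type*} [AddCommGroup N] [Finite N] [IsAddCyclic N]
    (K : AddSubgroup N) (S : Multiset β) (φ : β → N) (hφ : ∀ b ∈ S, φ b ∈ K) (L : ℕ)
    (hd : Nat.card K ∣ L) (h : L + Nat.card K ≤ Multiset.card S + 1) :
    ∃ T ≤ S, Multiset.card T = L ∧ (T.map φ).sum = 0 := by
  classical
  obtain ⟨j, rfl⟩ := hd
  have hk : 0 < Nat.card K := Nat.card_pos
  induction j generalizing S with
  | zero => exact ⟨0, Multiset.zero_le _, by simp⟩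
  | succ j ih =>
    let e := zmodAddCyclicAddEquiv (G := K) inferInstance
    let ψ : β → ZMod (Nat.card K) := fun b => if hb : φ b ∈ K then e.symm ⟨φ b, hb⟩ else 0
    have hψ : ∀ b ∈ S, ((e (ψ b) : K) : N) = φ b := by
      intro b hb
      simp [ψ, hφ b hb]
    have hsum : ∀ T ≤ S, ((e (T.map ψ).sum : K) : N) = (T.map φ).sum := by
      intro T hT
      have : ((e (T.map ψ).sum : K) : N) = (K.subtype.comp e.toAddMonoidHom) (T.map ψ).sum := rfl
      rw [this, AddMonoidHom.map_multiset_sum, Multiset.map_map]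
      congr 1
      exact Multiset.map_congr rfl fun b hb => hψ b (Multiset.mem_of_le hT hb)
    obtain ⟨T0, hT0, hc0, hs0⟩ := ZMod.erdos_ginzburg_ziv_multiset (S.map ψ)
      (by rw [Multiset.card_map]; rw [Nat.mul_succ] at h; omega)
    obtain ⟨T, hT, rfl⟩ := exists_le_map_eq hT0
    rw [Multiset.card_map] at hc0
    obtain ⟨T', hT', hc', hs'⟩ := ih (S - T)
      (fun b hb => hφ b (Multiset.mem_of_le (Multiset.sub_le_self _ _) hb))
      (by rw [Multiset.card_sub hT, hc0]; rw [Nat.mul_succ] at h; omega)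
    refine ⟨T + T', ?_, ?_, ?_⟩
    · rw [← add_tsub_cancel_of_le hT]
      exact add_le_add le_rfl hT'
    · rw [Multiset.card_add, hc0, hc', Nat.mul_succ, add_comm]
    · rw [Multiset.map_add, Multiset.sum_add, hs', ← hsum T hT, hs0]
      simp

end EGZ

/-! ### Sequences one term too short for Erdős–Ginzburg–Ziv. -/

section InverseEGZ

/-- Disjoint blocks of length `p` with sum divisible by `p`. -/
theorem exists_blocks (p j : ℕ) (S : Multiset ℤ)
    (h : (j + 1) * p ≤ Multiset.card S + 1) (hp : 1 ≤ p) :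
    ∃ Q : Multiset (Multiset ℤ), Multiset.card Q = j ∧ Q.join ≤ S ∧
      ∀ b ∈ Q, Multiset.card b = p ∧ (p : ℤ) ∣ b.sum := by
  induction j generalizing S with
  | zero => exact ⟨0, by simp⟩
  | succ j ih =>
    have hexp : (j + 1 + 1) * p = j * p + 2 * p := by ring
    obtain ⟨b, hb, hbc, hbs⟩ := Int.erdos_ginzburg_ziv_multiset (n := p) S
      (by rw [hexp] at h; have := Nat.zero_le (j * p); omega)
    obtain ⟨Q, hQc, hQ, hQb⟩ := ih (S - b) (by
      rw [Multiset.card_sub hb, hbc]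
      have := Multiset.card_le_card hb
      have hexp' : (j + 1) * p = j * p + p := by ring
      omega)
    refine ⟨b ::ₘ Q, by simp [hQc], ?_, ?_⟩
    · rw [Multiset.join_cons, ← add_tsub_cancel_of_le hb]
      exact add_le_add le_rfl hQ
    · intro c hc
      rcases Multiset.mem_cons.1 hc with rfl | hc
      · exact ⟨hbc, hbs⟩
      · exact hQb c hc

theorem card_join_of_forall_card {α : Type*} {Q : Multiset (Multiset α)} {p : ℕ}
    (h : ∀ b ∈ Q, Multiset.card b = p) : Multiset.card Q.join = Multiset.card Q * p := by
  rw [Multiset.card_join, Multiset.map_congr rfl h]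
  simp

theorem sum_join_eq {Q : Multiset (Multiset ℤ)} {p : ℤ} (h : ∀ b ∈ Q, p ∣ b.sum) :
    Q.join.sum = p * (Q.map fun b => b.sum / p).sum := by
  rw [Multiset.sum_join, ← Multiset.sum_map_mul_left]
  congr 1
  exact Multiset.map_congr rfl fun b hb => (Int.mul_ediv_cancel' (h b hb)).symm

theorem join_mono {α : Type*} {Q R : Multiset (Multiset α)} (h : Q ≤ R) : Q.join ≤ R.join := by
  obtain ⟨P, rfl⟩ := Multiset.le_iff_exists_add.1 h
  rw [Multiset.join_add]
  exact Multiset.le_add_right _ _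

/-- Prime case: among `2 p - 2` elements of `ZMod p` without `p` terms of sum zero, the sums of
`p` terms take every nonzero value. -/
theorem exists_sum_eq_of_prime (p : ℕ) [Fact p.Prime] (S : Multiset (ZMod p))
    (hS : Multiset.card S + 2 = 2 * p) :
    (∃ T ≤ S, Multiset.card T = p ∧ T.sum = 0) ∨
      ∀ t : ZMod p, t ≠ 0 → ∃ T ≤ S, Multiset.card T = p ∧ T.sum = t := by
  classical
  have hp : 2 ≤ p := (Fact.out : p.Prime).two_le
  by_cases hmul : ∃ a, p ≤ S.count a
  · obtain ⟨a, ha⟩ := hmul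
    exact Or.inl ⟨Multiset.replicate p a, Multiset.le_count_iff_replicate_le.1 ha, by simp, by simp⟩
  push Not at hmul
  obtain ⟨Q, rfl, hQ⟩ := exists_pairing_ne (p - 1) S (by omega)
    (fun a => by have := hmul a; omega)
  rw [card_flatten] at hS
  obtain ⟨q, hq⟩ := Multiset.card_pos_iff_exists_mem.1 (show 0 < Multiset.card Q by omega)
  obtain ⟨R, rfl⟩ := Multiset.exists_cons_of_mem hq
  rw [Multiset.card_cons] at hS
  -- The `p`-term sums used below contain both terms of `q` and one term of each of the other `p -
  -- 2` pairs; `D` records the effect of switching the choice.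
  set D : Multiset (ZMod p) := R.map fun r => r.2 - r.1 with hD
  have hDc : Multiset.card D = p - 2 := by rw [hD, Multiset.card_map]; omega
  have hcard : p - 1 ≤ (subsetSums D).card := by
    rcases eq_or_ne (periods (subsetSums D)) ⊥ with hb | hb
    · have h1 := card_filter_lt_card_subsetSums ⊥ D hb.le
      rw [Multiset.filter_eq_self.2] at h1
      · omega
      · intro d hd
        obtain ⟨r, hr, rfl⟩ := Multiset.mem_map.1 hd
        rw [AddSubgroup.mem_bot, sub_eq_zero]
        exact (hQ r (Multiset.mem_cons_of_mem hr)).symm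
    · have htop : periods (subsetSums D) = ⊤ := by
        have : IsSimpleAddGroup (ZMod p) := inferInstance
        exact (IsSimpleAddGroup.eq_bot_or_eq_top_of_normal _ inferInstance).resolve_left hb
      have huniv : subsetSums D = Finset.univ := by
        ext x
        have hx : x ∈ periods (subsetSums D) := by rw [htop]; trivial
        simpa using ((mem_periods.1 hx) 0).2 (zero_mem_subsetSums D)
      rw [huniv, Finset.card_univ, ZMod.card]
      omega
  have hreach : ∀ x ∈ subsetSums D, ∃ T ≤ flatten (q ::ₘ R), Multiset.card T = p ∧
      T.sum = q.1 + q.2 + (R.map Prod.fst).sum + x := by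
    intro x hx
    obtain ⟨T, hT, hTc, hTs⟩ := exists_choice_of_mem_subsetSums (φ := id) hx
    refine ⟨{q.1, q.2} + T, ?_, ?_, ?_⟩
    · rw [flatten_cons]
      exact add_le_add le_rfl hT
    · simp [hTc]; omega
    · simp at hTs
      simp [hTs]; ring
  by_contra! hcon
  obtain ⟨h0, t, ht0, ht⟩ := hcon
  set c := q.1 + q.2 + (R.map Prod.fst).sum
  -- These sums would avoid both `0` and `t`, but there are at least `p - 1` of them.
  have hsub : (subsetSums D).image (c + ·) ⊆ {0, t}ᶜ := by
    intro y hy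
    obtain ⟨x, hx, rfl⟩ := Finset.mem_image.1 hy
    obtain ⟨T, hT, hTc, hTs⟩ := hreach x hx
    simp only [Finset.mem_compl, Finset.mem_insert, Finset.mem_singleton, not_or]
    exact ⟨fun h => h0 T hT hTc (hTs.trans h), fun h => ht T hT hTc (hTs.trans h)⟩
  have hle := Finset.card_le_card hsub
  rw [Finset.card_image_of_injective _ (add_right_injective c), Finset.card_compl, ZMod.card,
    Finset.card_pair ht0.symm] at hle
  omega

/-- Induction on the prime factors of `M = p * k`. Take out `2 * k - 2` blocks of length `p` with
sum divisible by `p`; exactly `2 * p - 2` terms remain. A target divisible by `p` is reached by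
blocks alone, by induction; any other target by `p` of the remaining terms, correct modulo `p`,
together with `k - 1` blocks correcting the quotient. -/
theorem exists_dvd_sum_sub (M : ℕ) (S : Multiset ℤ) (hS : Multiset.card S + 2 = 2 * M) :
    (∃ T ≤ S, Multiset.card T = M ∧ (M : ℤ) ∣ T.sum) ∨
      ∀ t : ℤ, ¬ (M : ℤ) ∣ t → ∃ T ≤ S, Multiset.card T = M ∧ (M : ℤ) ∣ T.sum - t := by
  classical
  induction M using induction_on_primes generalizing S with
  | zero => omega
  | one => exact Or.inr fun t ht => absurd (by simp) ht
  | prime_mul p k hp ih =>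
    have := Fact.mk hp
    have hp2 := hp.two_le
    have hk : 1 ≤ k := by
      rcases Nat.eq_zero_or_pos k with rfl | hk
      · omega
      · exact hk
    obtain ⟨k', rfl⟩ : ∃ k', k = k' + 1 := ⟨k - 1, by omega⟩
    obtain ⟨Q, hQc, hQ, hQb⟩ := exists_blocks p (2 * k') S (by
      have : 2 * (p * (k' + 1)) = (2 * k' + 1) * p + p := by ring
      omega) (by omega)
    set V : Multiset ℤ := Q.map fun b => b.sum / p with hV
    have hlift : ∀ U ≤ V, ∃ T ≤ Q.join, Multiset.card T = Multiset.card U * p ∧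
        T.sum = p * U.sum := by
      intro U hU
      obtain ⟨P, hP, rfl⟩ := exists_le_map_eq hU
      refine ⟨P.join, join_mono hP, ?_, ?_⟩
      · rw [card_join_of_forall_card fun b hb => (hQb b (Multiset.mem_of_le hP hb)).1,
          Multiset.card_map]
      · exact sum_join_eq fun b hb => (hQb b (Multiset.mem_of_le hP hb)).2
    have hVc : Multiset.card V = 2 * k' := by rw [hV, Multiset.card_map, hQc]
    by_cases hzero : ∃ T ≤ S, Multiset.card T = p * (k' + 1) ∧ ((p * (k' + 1) : ℕ) : ℤ) ∣ T.sum
    · exact Or.inl hzero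
    refine Or.inr ?_
    obtain ⟨R, hR⟩ := Multiset.le_iff_exists_add.1 hQ
    have hQle : Q.join ≤ S := hQ
    have hRc : Multiset.card R + 2 = 2 * p := by
      rw [hR, Multiset.card_add, card_join_of_forall_card fun b hb => (hQb b hb).1, hQc] at hS
      have : 2 * (p * (k' + 1)) = 2 * k' * p + 2 * p := by ring
      omega
    have hV0 : ¬ ∃ U ≤ V, Multiset.card U = k' + 1 ∧ ((k' + 1 : ℕ) : ℤ) ∣ U.sum := by
      rintro ⟨U, hU, hUc, hUs⟩
      obtain ⟨T, hT, hTc, hTs⟩ := hlift U hU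
      exact hzero ⟨T, hT.trans hQle, by rw [hTc, hUc, mul_comm],
        by rw [hTs]; push_cast at hUs ⊢; exact mul_dvd_mul_left _ hUs⟩
    -- EGZ on `V` with `-u` appended: the zero sum must use `-u`, since `V` alone has none.
    have hall : ∀ u : ℤ, ∃ U ≤ V, Multiset.card U = k' ∧ ((k' + 1 : ℕ) : ℤ) ∣ U.sum - u := by
      intro u
      obtain ⟨U, hU, hUc, hUs⟩ := Int.erdos_ginzburg_ziv_multiset (n := k' + 1) ((-u) ::ₘ V)
        (by rw [Multiset.card_cons]; omega)
      rcases le_cons_cases hU with h | ⟨U', hU', rfl⟩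
      · exact absurd ⟨U, h, hUc, hUs⟩ hV0
      · refine ⟨U', hU', by simpa using hUc, ?_⟩
        rw [Multiset.sum_cons] at hUs
        rwa [sub_eq_neg_add]
    -- Such a `T` could be completed by `k'` blocks to a sum divisible by `p * (k' + 1)`.
    have hR0 : ¬ ∃ T ≤ R, Multiset.card T = p ∧ (p : ℤ) ∣ T.sum := by
      rintro ⟨T, hT, hTc, u, hu⟩
      obtain ⟨U, hU, hUc, hUs⟩ := hall (-u)
      obtain ⟨T', hT', hTc', hTs'⟩ := hlift U hU
      refine hzero ⟨T' + T, hR ▸ add_le_add hT' hT, ?_, ?_⟩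
      · rw [Multiset.card_add, hTc, hTc', hUc]; ring
      · rw [Multiset.sum_add, hTs', hu, ← mul_add]
        push_cast at hUs ⊢
        exact mul_dvd_mul_left _ (by simpa using hUs)
    intro t ht
    by_cases hpt : (p : ℤ) ∣ t
    · obtain ⟨t', rfl⟩ := hpt
      have ht' : ¬ ((k' + 1 : ℕ) : ℤ) ∣ t' := by
        intro h
        exact ht (by push_cast at h ⊢; exact mul_dvd_mul_left _ h)
      obtain ⟨U, hU, hUc, hUs⟩ := ((ih V (by omega)).resolve_left hV0) t' ht'
      obtain ⟨T, hT, hTc, hTs⟩ := hlift U hU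
      refine ⟨T, hT.trans hQle, by rw [hTc, hUc, mul_comm], ?_⟩
      rw [hTs, ← mul_sub]
      push_cast at hUs ⊢
      exact mul_dvd_mul_left _ hUs
    · have key := exists_sum_eq_of_prime p (R.map fun z : ℤ => (z : ZMod p))
        (by rwa [Multiset.card_map])
      have hcast : ∀ T : Multiset ℤ, (T.map fun z : ℤ => (z : ZMod p)).sum = (T.sum : ZMod p) := by
        intro T
        exact (map_multiset_sum (Int.castRingHom (ZMod p)) T).symm
      rcases key with ⟨T, hT, hTc, hTs⟩ | key
      · obtain ⟨T, hTR, rfl⟩ := exists_le_map_eq hT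
        rw [hcast, ZMod.intCast_zmod_eq_zero_iff_dvd] at hTs
        exact absurd ⟨T, hTR, by simpa using hTc, hTs⟩ hR0
      · obtain ⟨T, hT, hTc, hTs⟩ := key t
          (by rwa [ne_eq, ZMod.intCast_zmod_eq_zero_iff_dvd])
        obtain ⟨T, hTR, rfl⟩ := exists_le_map_eq hT
        rw [hcast, ← sub_eq_zero, ← Int.cast_sub, ZMod.intCast_zmod_eq_zero_iff_dvd] at hTs
        obtain ⟨u, hu⟩ := hTs
        obtain ⟨U, hU, hUc, hUs⟩ := hall (-u)
        obtain ⟨T', hT', hTc', hTs'⟩ := hlift U hU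
        refine ⟨T' + T, hR ▸ add_le_add hT' hTR, ?_, ?_⟩
        · rw [Multiset.card_map] at hTc
          rw [Multiset.card_add, hTc, hTc', hUc]; ring
        · rw [Multiset.sum_add, hTs', add_sub_assoc, hu, ← mul_add]
          push_cast at hUs ⊢
          exact mul_dvd_mul_left _ (by simpa using hUs)

/-- Among `2 M - 2` elements of a cyclic subgroup of order `M`, either `M` of them have sum zero,
or the sums of `M` of them take every nonzero value. -/
theorem exists_sum_eq_of_addSubgroup {N β : Type*} [AddCommGroup N] [Finite N] [IsAddCyclic N]
    (K : AddSubgroup N) (S : Multiset β) (φ : β → N) (hφ : ∀ b ∈ S, φ b ∈ K)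
    (hS : Multiset.card S + 2 = 2 * Nat.card K) :
    (∃ T ≤ S, Multiset.card T = Nat.card K ∧ (T.map φ).sum = 0) ∨
      ∀ t ∈ K, t ≠ 0 → ∃ T ≤ S, Multiset.card T = Nat.card K ∧ (T.map φ).sum = t := by
  obtain ⟨g, hg⟩ := IsAddCyclic.exists_generator (α := K)
  have hord : addOrderOf g = Nat.card K := addOrderOf_eq_card_of_forall_mem_zmultiples hg
  have hz : ∀ z : ℤ, z • (g : N) = 0 ↔ (Nat.card K : ℤ) ∣ z := by
    intro z
    rw [← hord, addOrderOf_dvd_iff_zsmul_eq_zero]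
    norm_cast
  have hrep : ∀ a ∈ K, ∃ z : ℤ, z • (g : N) = a := by
    intro a ha
    obtain ⟨z, hz⟩ := AddSubgroup.mem_zmultiples_iff.1 (hg ⟨a, ha⟩)
    exact ⟨z, by simpa using congrArg Subtype.val hz⟩
  have hrep' : ∀ b : β, ∃ z : ℤ, φ b ∈ K → z • (g : N) = φ b := by
    intro b
    by_cases hb : φ b ∈ K
    · obtain ⟨z, hz⟩ := hrep _ hb
      exact ⟨z, fun _ => hz⟩
    · exact ⟨0, fun h => absurd h hb⟩
  choose ψ hψ using hrep'
  have hsum : ∀ T ≤ S, (T.map φ).sum = (T.map ψ).sum • (g : N) := by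
    intro T hT
    rw [Multiset.sum_smul, Multiset.map_map]
    congr 1
    exact Multiset.map_congr rfl fun b hb => (hψ b (hφ b (Multiset.mem_of_le hT hb))).symm
  rcases exists_dvd_sum_sub (Nat.card K) (S.map ψ) (by rwa [Multiset.card_map]) with
    ⟨T, hT, hTc, hTs⟩ | h
  · obtain ⟨T, hTS, rfl⟩ := exists_le_map_eq hT
    exact Or.inl ⟨T, hTS, by simpa using hTc, by rw [hsum T hTS, hz]; exact hTs⟩
  · refine Or.inr fun t ht ht0 => ?_
    obtain ⟨z, rfl⟩ := hrep t ht
    obtain ⟨T, hT, hTc, hTs⟩ := h z (by rwa [← hz])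
    obtain ⟨T, hTS, rfl⟩ := exists_le_map_eq hT
    refine ⟨T, hTS, by simpa using hTc, ?_⟩
    rw [hsum T hTS, ← sub_eq_zero, ← sub_smul, hz]
    exact hTs

end InverseEGZ

/-- A description of a group `G` as `{y a, x (y a) | a ∈ N}` for an abelian group `N`,
an involution `x` and the endomorphism `σ` of `N` given by conjugation with `x`. -/
structure Frame (G N : Type*) [Group G] [AddCommGroup N] where
  y : N → G
  x : G
  σ : N →+ N
  y_add : ∀ a b, y (a + b) = y a * y b
  x_mul_x : x * x = 1
  y_mul_x : ∀ a, y a * x = x * y (σ a)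
  σ_σ : ∀ a, σ (σ a) = a

/-! ### Products of sequences in normal form. -/

namespace Frame

variable {G N : Type*} [Group G] [AddCommGroup N] (F : Frame G N)

theorem y_zero : F.y 0 = 1 := by
  have := F.y_add 0 0
  simpa using this

/-- The group element named by `(false, a)` is `y a`, the one named by `(true, a)` is `x (y a)`. -/
def ev (t : Bool × N) : G := if t.1 then F.x * F.y t.2 else F.y t.2

@[simp] theorem ev_false (a : N) : F.ev (false, a) = F.y a := rfl

@[simp] theorem ev_true (a : N) : F.ev (true, a) = F.x * F.y a := rfl

/-- The terms named by `T` can be ordered so that their product is `y c`. -/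
def Ach (T : Multiset (Bool × N)) (c : N) : Prop :=
  ∃ l : List (Bool × N), (l : Multiset (Bool × N)) = T ∧ (l.map F.ev).prod = F.y c

variable {F}

theorem Ach.isProductOne {T : Multiset (Bool × N)} (h : F.Ach T 0) : IsProductOne (T.map F.ev) := by
  obtain ⟨l, rfl, hl⟩ := h
  exact ⟨l.map F.ev, by simp, by rw [hl, F.y_zero]⟩

theorem Ach.add {T U : Multiset (Bool × N)} {c d : N} (hT : F.Ach T c) (hU : F.Ach U d) :
    F.Ach (T + U) (c + d) := by
  obtain ⟨l, rfl, hl⟩ := hT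
  obtain ⟨k, rfl, hk⟩ := hU
  exact ⟨l ++ k, by simp, by rw [List.map_append, List.prod_append, hl, hk, F.y_add]⟩

theorem ach_zero : F.Ach 0 0 := ⟨[], rfl, by simp [F.y_zero]⟩

theorem ach_single (a : N) : F.Ach {(false, a)} a := ⟨[(false, a)], rfl, by simp⟩

theorem ach_map_false (A : Multiset N) : F.Ach (A.map fun a => (false, a)) A.sum := by
  induction A using Multiset.induction with
  | empty => exact ach_zero
  | cons a A ih =>
    rw [Multiset.map_cons, Multiset.sum_cons, ← Multiset.singleton_add]
    exact (ach_single a).add ih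

/-- A product of terms of `N` enclosed by two terms outside of `N` is twisted by `σ`. -/
theorem Ach.flip {T U : Multiset (Bool × N)} {c d : N} (b b' : N) (hT : F.Ach T c)
    (hU : F.Ach U d) :
    F.Ach ({(true, b), (true, b')} + (T + U)) (F.σ b + b' + F.σ c + d) := by
  obtain ⟨l, rfl, hl⟩ := hT
  obtain ⟨k, rfl, hk⟩ := hU
  refine ⟨(true, b) :: (l ++ (true, b') :: k), ?_, ?_⟩
  · simp only [Multiset.insert_eq_cons, ← Multiset.cons_coe, ← Multiset.coe_add,
      ← Multiset.singleton_add]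
    abel
  · rw [List.map_cons, List.map_append, List.map_cons, List.prod_cons, List.prod_append,
      List.prod_cons, hl, hk, ev_true, ev_true]
    calc F.x * F.y b * (F.y c * (F.x * F.y b' * F.y d))
        = F.x * (F.y (b + c) * F.x) * (F.y b' * F.y d) := by
          rw [F.y_add]; simp only [mul_assoc]
      _ = F.x * F.x * F.y (F.σ (b + c)) * F.y (b' + d) := by
          rw [F.y_mul_x, F.y_add b']; simp only [mul_assoc]
      _ = _ := by
          rw [F.x_mul_x, one_mul, ← F.y_add, map_add]
          congr 1; abel

theorem ach_pair (b b' : N) : F.Ach {(true, b), (true, b')} (F.σ b + b') := by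
  simpa using Ach.flip b b' (ach_zero (F := F)) (ach_zero (F := F))

variable (F) in
/-- The product of a pair of terms of the same type. -/
def val (q : (Bool × N) × (Bool × N)) : N :=
  if q.1.1 then F.σ q.1.2 + q.2.2 else q.1.2 + q.2.2

theorem ach_flatten (Q : Multiset ((Bool × N) × (Bool × N))) (hQ : ∀ q ∈ Q, q.1.1 = q.2.1) :
    F.Ach (flatten Q) (Q.map F.val).sum := by
  induction Q using Multiset.induction with
  | empty => exact ach_zero
  | cons q Q ih =>
    rw [flatten_cons, Multiset.map_cons, Multiset.sum_cons]
    refine Ach.add ?_ (ih fun q hq => hQ q (Multiset.mem_cons_of_mem hq))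
    have h := hQ q (Multiset.mem_cons_self _ _)
    obtain ⟨⟨e, a⟩, ⟨e', a'⟩⟩ := q
    obtain rfl : e = e' := h
    cases e
    · exact (ach_single a).add (ach_single a')
    · exact ach_pair a a'

/-- Among pairs of terms of the same type whose products lie in a cyclic group of order
dividing `L`, one finds `L` pairs with product one. -/
theorem exists_ach_of_pairs [Finite N] [IsAddCyclic N] (K : AddSubgroup N)
    (Q : Multiset ((Bool × N) × (Bool × N))) (hQ : ∀ q ∈ Q, q.1.1 = q.2.1)
    (hK : ∀ q ∈ Q, F.val q ∈ K) (L : ℕ) (hd : Nat.card K ∣ L)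
    (h : L + Nat.card K ≤ Multiset.card Q + 1) :
    ∃ T ≤ flatten Q, Multiset.card T = 2 * L ∧ F.Ach T 0 := by
  obtain ⟨P, hP, hPc, hPs⟩ := exists_zero_sum_of_addSubgroup K Q F.val hK L hd h
  refine ⟨flatten P, flatten_mono hP, by rw [card_flatten, hPc], ?_⟩
  rw [← hPs]
  exact ach_flatten P fun q hq => hQ q (Multiset.mem_of_le hP hq)

/-! ### Even order: classes by type and parity. -/

section Even

/-- Any paired term can take the place of the leftover term of its class, so what is proved about
leftover terms holds for all terms. -/
theorem exists_swap {α β : Type*} {κ : α → β} {S : Multiset α} {Q : Multiset (α × α)} {l g : α}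
    {L : Multiset α} (hQS : flatten Q + l ::ₘ L = S) (hQ : ∀ q ∈ Q, κ q.1 = κ q.2)
    (hg : g ∈ flatten Q) (hgl : κ g = κ l) :
    ∃ Q' : Multiset (α × α), flatten Q' + g ::ₘ L = S ∧ ∀ q ∈ Q', κ q.1 = κ q.2 := by
  classical
  have hkey : ∃ q ∈ Q, ∃ h, κ h = κ g ∧ ({q.1, q.2} : Multiset α) = {g, h} := by
    rcases Multiset.mem_add.1 hg with hg | hg
    · obtain ⟨q, hq, rfl⟩ := Multiset.mem_map.1 hg
      exact ⟨q, hq, q.2, (hQ q hq).symm, rfl⟩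
    · obtain ⟨q, hq, rfl⟩ := Multiset.mem_map.1 hg
      exact ⟨q, hq, q.1, hQ q hq, Multiset.cons_swap _ _ _⟩
  obtain ⟨q, hq, h, hh, hqh⟩ := hkey
  obtain ⟨R, rfl⟩ := Multiset.exists_cons_of_mem hq
  refine ⟨(l, h) ::ₘ R, ?_, ?_⟩
  · rw [← hQS, flatten_cons, flatten_cons, hqh]
    simp only [Multiset.insert_eq_cons, ← Multiset.singleton_add]
    abel
  · intro r hr
    rcases Multiset.mem_cons.1 hr with rfl | hr
    · exact hgl.symm.trans hh.symm
    · exact hQ r (Multiset.mem_cons_of_mem hr)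

variable {par : N →+ ZMod 2}

theorem val_mem_ker (hσ : ∀ a, par (F.σ a) = par a) {q : (Bool × N) × (Bool × N)}
    (h : par q.1.2 = par q.2.2) : F.val q ∈ par.ker := by
  rw [AddMonoidHom.mem_ker, val]
  split_ifs <;> simp [hσ, h, CharTwo.add_self_eq_zero]

theorem two_mul_card_ker (hpar : Function.Surjective par) :
    2 * Nat.card par.ker = Nat.card N := by
  have h := AddSubgroup.card_mul_index par.ker
  rw [AddSubgroup.index_ker, AddMonoidHom.range_eq_top.2 hpar] at h
  rw [AddSubgroup.card_top, Nat.card_zmod] at h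
  omega

variable [Finite N] [IsAddCyclic N]

/-- If all but one term of each of the four classes modulo squares are paired up inside these
classes, then either there is a product-one sequence or the remaining terms commute. -/
theorem commute_of_pairs (hσ : ∀ a, par (F.σ a) = par a) (hpar : Function.Surjective par)
    {S : Multiset (Bool × N)} (hS : Multiset.card S = 2 * Nat.card N)
    (hno : ¬ ∃ T ≤ S, Multiset.card T = Nat.card N ∧ F.Ach T 0)
    {Q : Multiset ((Bool × N) × (Bool × N))} {a a' b b' : N}
    (hQS : flatten Q + {(false, a), (false, a'), (true, b), (true, b')} = S)
    (hQ : ∀ q ∈ Q, q.1.1 = q.2.1 ∧ par q.1.2 = par q.2.2)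
    (ha : par a = 0) (ha' : par a' = 1) (hb : par b = 0) (hb' : par b' = 1) :
    F.σ a = a ∧ F.σ a' = a' ∧ F.σ b - b = F.σ b' - b' := by
  have hM := two_mul_card_ker hpar
  have hM0 : 0 < Nat.card par.ker := Nat.card_pos
  have hQc : Multiset.card Q + 2 = 2 * Nat.card par.ker := by
    have := congrArg Multiset.card hQS
    simp at this
    omega
  have key := exists_sum_eq_of_addSubgroup par.ker Q F.val
    (fun q hq => val_mem_ker hσ (hQ q hq).2) hQc
  -- If the total of all pairs plus `w` were nonzero, `Nat.card par.ker` pairs would have exactly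
  -- that sum; deleting them leaves the other pairs and the four leftover terms, with product one
  -- and length `Nat.card N`.
  have hw : ∀ w, F.Ach {(false, a), (false, a'), (true, b), (true, b')} w →
      par w = 0 → w = -(Q.map F.val).sum := by
    intro w hw hw0
    by_contra hne
    apply hno
    rcases key with ⟨T, hT, hTc, hTs⟩ | key
    · refine ⟨flatten T, ?_, by rw [card_flatten, hTc, hM], ?_⟩
      · rw [← hQS]
        exact (flatten_mono hT).trans (Multiset.le_add_right _ _)
      · rw [← hTs]
        exact ach_flatten T fun q hq => (hQ q (Multiset.mem_of_le hT hq)).1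
    · have hmem : (Q.map F.val).sum + w ∈ par.ker := by
        refine add_mem (multiset_sum_mem _ ?_) hw0
        intro v hv
        obtain ⟨q, hq, rfl⟩ := Multiset.mem_map.1 hv
        exact val_mem_ker hσ (hQ q hq).2
      obtain ⟨T, hT, hTc, hTs⟩ := key _ hmem (fun h => hne (by
        rw [eq_neg_iff_add_eq_zero, add_comm]; exact h))
      obtain ⟨R, rfl⟩ := Multiset.le_iff_exists_add.1 hT
      refine ⟨flatten R + {(false, a), (false, a'), (true, b), (true, b')}, ?_, ?_, ?_⟩
      · rw [← hQS]
        exact add_le_add (flatten_mono (Multiset.le_add_left _ _)) le_rfl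
      · simp only [Multiset.card_add] at hQc
        simp
        omega
      · have hR := (ach_flatten (F := F) R fun q hq =>
          (hQ q (Multiset.mem_add.2 (Or.inr hq))).1).add hw
        convert hR using 1
        rw [Multiset.map_add, Multiset.sum_add] at hTs
        have h0 : (T.map F.val).sum + ((R.map F.val).sum + w) = (T.map F.val).sum + 0 := by
          rw [← add_assoc, ← hTs, add_zero]
        exact (add_left_cancel h0).symm
  have e2 : (1 : ZMod 2) + 1 = 0 := rfl
  -- The orderings differ in which terms of `N` stand between the two outside terms, and in the
  -- order of the latter. Comparing their forced common value gives the three equations.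
  have h0 := hw (F.σ b + b' + F.σ 0 + (a + a')) (by
    convert Ach.flip b b' ach_zero ((ach_single a).add (ach_single a')) using 1
    simp only [Multiset.insert_eq_cons, ← Multiset.singleton_add]; abel)
    (by simp [hσ, ha, ha', hb, hb', e2])
  have h1 := hw (F.σ b + b' + F.σ a + a') (by
    convert Ach.flip b b' (ach_single a) (ach_single a') using 1
    simp only [Multiset.insert_eq_cons, ← Multiset.singleton_add]; abel)
    (by simp [hσ, ha, ha', hb, hb', e2])
  have h2 := hw (F.σ b + b' + F.σ a' + a) (by
    convert Ach.flip b b' (ach_single a') (ach_single a) using 1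
    simp only [Multiset.insert_eq_cons, ← Multiset.singleton_add]; abel)
    (by simp [hσ, ha, ha', hb, hb', e2])
  have h3 := hw (F.σ b' + b + F.σ 0 + (a + a')) (by
    convert Ach.flip b' b ach_zero ((ach_single a).add (ach_single a')) using 1
    simp only [Multiset.insert_eq_cons, ← Multiset.singleton_add]; abel)
    (by simp [hσ, ha, ha', hb, hb', e2])
  rw [map_zero, add_zero] at h0 h3
  refine ⟨?_, ?_, ?_⟩
  · have := h1.trans h0.symm
    rw [add_assoc] at this
    exact add_right_cancel (add_left_cancel this)
  · have := h2.trans h0.symm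
    rw [add_assoc, add_comm a a'] at this
    exact add_right_cancel (add_left_cancel this)
  · have := add_right_cancel (h0.trans h3.symm)
    rw [sub_eq_sub_iff_add_eq_add, this]

theorem exists_ach_card (hσ : ∀ a, par (F.σ a) = par a) (hpar : Function.Surjective par)
    (hne : ∃ a, F.σ a ≠ a)
    (S : Multiset (Bool × N)) (hS : Multiset.card S = 2 * Nat.card N) :
    ∃ T ≤ S, Multiset.card T = Nat.card N ∧ F.Ach T 0 := by
  classical
  have hM := two_mul_card_ker hpar
  by_contra hno
  let κ : Bool × N → Bool × ZMod 2 := fun t => (t.1, par t.2)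
  have hκ : ∀ {Q : Multiset ((Bool × N) × (Bool × N))}, (∀ q ∈ Q, κ q.1 = κ q.2) →
      ∀ q ∈ Q, q.1.1 = q.2.1 ∧ par q.1.2 = par q.2.2 :=
    fun h q hq => Prod.ext_iff.1 (h q hq)
  obtain ⟨Q, L, hQS, hQ, hL⟩ := exists_pairing κ S
  have hQle : flatten Q ≤ S := hQS ▸ Multiset.le_add_right _ _
  have hcard := congrArg Multiset.card hQS
  rw [Multiset.card_add, card_flatten, hS] at hcard
  have hLu : L.map κ ≤ (Finset.univ : Finset (Bool × ZMod 2)).val :=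
    (Multiset.le_iff_subset hL).2 fun x _ => Finset.mem_univ x
  have hLc : Multiset.card L ≤ 4 := by
    simpa using Multiset.card_le_card hLu
  have hpairs : ∀ K : AddSubgroup N, (∀ q ∈ Q, F.val q ∈ K) → Nat.card K ∣ Nat.card par.ker →
      ¬ Nat.card par.ker + Nat.card K ≤ Multiset.card Q + 1 := by
    intro K hK hd h
    obtain ⟨T, hT, hTc, hT0⟩ := exists_ach_of_pairs K Q (fun q hq => (hκ hQ q hq).1) hK _ hd h
    exact hno ⟨T, hT.trans hQle, by omega, hT0⟩
  -- The number of leftover terms is even, so fewer than four means at most two, which leaves enough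
  -- pairs for EGZ in `par.ker`.
  have hL4 : Multiset.card L = 4 := by
    by_contra h
    exact hpairs par.ker (fun q hq => val_mem_ker hσ (hκ hQ q hq).2) dvd_rfl (by omega)
  have hLeq : L.map κ = {(false, 0), (false, 1), (true, 0), (true, 1)} :=
    (Multiset.eq_of_le_of_card_le hLu (by simp [hL4])).trans (by decide)
  obtain ⟨a, a', b, b', ha, ha', hb, hb', rfl⟩ : ∃ a a' b b' : N, par a = 0 ∧ par a' = 1 ∧
      par b = 0 ∧ par b' = 1 ∧ L = {(false, a), (false, a'), (true, b), (true, b')} := by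
    obtain ⟨t, ht, hκt, h⟩ := (Multiset.map_eq_cons _ _ _ _).2 hLeq
    obtain ⟨t', ht', hκt', h⟩ := (Multiset.map_eq_cons _ _ _ _).2 h
    obtain ⟨u, hu, hκu, h⟩ := (Multiset.map_eq_cons _ _ _ _).2 h
    obtain ⟨u', hu', hκu'⟩ := Multiset.map_eq_singleton.1 h
    obtain ⟨e1, a⟩ := t
    obtain ⟨e2, a'⟩ := t'
    obtain ⟨e3, b⟩ := u
    obtain ⟨e4, b'⟩ := u'
    simp only [κ, Prod.mk.injEq] at hκt hκt' hκu hκu'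
    obtain ⟨rfl, h1⟩ := hκt
    obtain ⟨rfl, h2⟩ := hκt'
    obtain ⟨rfl, h3⟩ := hκu
    obtain ⟨rfl, h4⟩ := hκu'
    refine ⟨a, a', b, b', h1, h2, h3, h4, ?_⟩
    rw [← Multiset.cons_erase ht, ← Multiset.cons_erase ht', ← Multiset.cons_erase hu, hu']
    rfl
  have hcomm := commute_of_pairs hσ hpar hS hno hQS (hκ hQ) ha ha' hb hb'
  have hfix : ∀ t ∈ flatten Q, if t.1 then F.σ t.2 - t.2 = F.σ b - b else F.σ t.2 = t.2 := by
    rintro ⟨e, c⟩ ht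
    have hc : par c = 0 ∨ par c = 1 := by
      generalize par c = z
      revert z
      decide
    cases e
    · rcases hc with hc | hc
      · obtain ⟨Q', hQ'S, hQ'⟩ := exists_swap (κ := κ) (l := (false, a)) hQS hQ ht
          (by simp [κ, hc, ha])
        exact (commute_of_pairs hσ hpar hS hno hQ'S (hκ hQ') hc ha' hb hb').1
      · obtain ⟨Q', hQ'S, hQ'⟩ := exists_swap (κ := κ) (l := (false, a'))
          (L := {(false, a), (true, b), (true, b')}) (S := S)
          (by rw [← hQS]; congr 1; exact Multiset.cons_swap _ _ _) hQ ht (by simp [κ, hc, ha'])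
        exact (commute_of_pairs hσ hpar hS hno (a := a) (a' := c) (b := b) (b' := b')
          (by rw [← hQ'S]; congr 1; exact Multiset.cons_swap _ _ _) (hκ hQ') ha hc hb hb').2.1
    · rcases hc with hc | hc
      · obtain ⟨Q', hQ'S, hQ'⟩ := exists_swap (κ := κ) (l := (true, b))
          (L := {(false, a), (false, a'), (true, b')}) (S := S)
          (by rw [← hQS]
              simp only [Multiset.insert_eq_cons, ← Multiset.singleton_add]; abel)
          hQ ht (by simp [κ, hc, hb])
        have := (commute_of_pairs hσ hpar hS hno (a := a) (a' := a') (b := c) (b' := b')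
          (by rw [← hQ'S]
              simp only [Multiset.insert_eq_cons, ← Multiset.singleton_add]; abel)
          (hκ hQ') ha ha' hc hb').2.2
        exact this.trans hcomm.2.2.symm
      · obtain ⟨Q', hQ'S, hQ'⟩ := exists_swap (κ := κ) (l := (true, b'))
          (L := {(false, a), (false, a'), (true, b)}) (S := S)
          (by rw [← hQS]
              simp only [Multiset.insert_eq_cons, ← Multiset.singleton_add]; abel)
          hQ ht (by simp [κ, hc, hb'])
        exact (commute_of_pairs hσ hpar hS hno (a := a) (a' := a') (b := b) (b' := c)
          (by rw [← hQ'S]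
              simp only [Multiset.insert_eq_cons, ← Multiset.singleton_add]; abel)
          (hκ hQ') ha ha' hb hc).2.2.symm
  let K : AddSubgroup N := par.ker ⊓ F.σ.eqLocus (AddMonoidHom.id N)
  -- `K` is proper in `par.ker`: otherwise `σ` fixes `par.ker` and the odd element `a'`, hence
  -- everything. Its order is then at most half, so the pairs at hand suffice for EGZ in `K`.
  have hKle : K ≤ par.ker := inf_le_left
  have hKlt : Nat.card K < Nat.card par.ker := by
    refine lt_of_le_of_ne (AddSubgroup.card_le_of_le hKle) fun h => ?_
    have hKeq : K = par.ker := AddSubgroup.eq_of_le_of_card_ge hKle h.ge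
    have hker : ∀ c, par c = 0 → F.σ c = c := by
      intro c hc
      have : c ∈ K := by rw [hKeq]; exact hc
      exact this.2
    obtain ⟨c, hc⟩ := hne
    apply hc
    have hpc : par c = 0 ∨ par c = 1 := by
      generalize par c = z
      revert z
      decide
    rcases hpc with h0 | h1
    · exact hker c h0
    · have := hker (c - a') (by rw [map_sub, h1, ha', sub_self])
      rw [map_sub, hcomm.2.1] at this
      exact sub_left_injective this
  have hKd : Nat.card K ∣ Nat.card par.ker := AddSubgroup.card_dvd_of_le hKle
  refine hpairs K ?_ hKd ?_
  · intro q hq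
    refine ⟨val_mem_ker hσ (hκ hQ q hq).2, ?_⟩
    have h1 := hfix q.1 (fst_mem_flatten hq)
    have h2 := hfix q.2 (snd_mem_flatten hq)
    rw [← (hκ hQ q hq).1] at h2
    change F.σ (F.val q) = F.val q
    rw [val]
    split_ifs at h1 h2 ⊢ with h
    · have h3 := h1.trans h2.symm
      rw [map_add, F.σ_σ]
      rw [sub_eq_sub_iff_add_eq_add] at h3
      rw [h3]; abel
    · rw [map_add, h1, h2]
  · obtain ⟨j, hj⟩ := hKd
    have hj2 : 2 ≤ j := by
      by_contra h
      interval_cases j <;> omega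
    have : Nat.card K * 2 ≤ Nat.card K * j := Nat.mul_le_mul_left _ hj2
    omega

end Even

end Frame

/-! ### Further splittings and pairings. -/

section Multisets

variable {α : Type*}

theorem exists_add_of_le_add {S T U : Multiset α} (h : S ≤ T + U) :
    ∃ S₁ ≤ T, ∃ S₂ ≤ U, S = S₁ + S₂ := by
  classical
  refine ⟨S ∩ T, Multiset.inter_le_right, S - T, ?_, ?_⟩
  · rw [tsub_le_iff_left]; exact h
  · rw [add_comm, Multiset.sub_add_inter]

theorem exists_flatten_eq_of_even {S : Multiset α} (h : Even (Multiset.card S)) :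
    ∃ Q : Multiset (α × α), flatten Q = S := by
  obtain ⟨Q, L, rfl, -, hL⟩ := exists_pairing (fun _ => ()) S
  have hLc : Multiset.card L ≤ 1 := by
    have h1 : L.map (fun _ => ()) ≤ (Finset.univ : Finset Unit).val :=
      (Multiset.le_iff_subset hL).2 fun x _ => Finset.mem_univ x
    simpa using Multiset.card_le_card h1
  have hL0 : Multiset.card L = 0 := by
    rw [Multiset.card_add, card_flatten] at h
    obtain ⟨k, hk⟩ := h
    omega
  exact ⟨Q, by rw [Multiset.card_eq_zero.1 hL0, add_zero]⟩

theorem exists_flatten_le_of_card (S : Multiset α) (k : ℕ) (h : 2 * k ≤ Multiset.card S) :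
    ∃ Q : Multiset (α × α), flatten Q ≤ S ∧ Multiset.card Q = k := by
  obtain ⟨T, hT, hTc⟩ := exists_le_card h
  obtain ⟨Q, rfl⟩ := exists_flatten_eq_of_even (S := T) (by rw [hTc]; exact even_two_mul k)
  exact ⟨Q, hT, by rw [card_flatten] at hTc; omega⟩

theorem add_le_of_le_sub [DecidableEq α] {S T U : Multiset α} (hT : T ≤ S) (hU : U ≤ S - T) :
    T + U ≤ S := by
  rw [← add_tsub_cancel_of_le hT]
  exact add_le_add le_rfl hU

theorem exists_terms_eq {N : Type*} (S : Multiset (Bool × N)) :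
    ∃ A B : Multiset N, A.map (Prod.mk false) + B.map (Prod.mk true) = S := by
  induction S using Multiset.induction with
  | empty => exact ⟨0, 0, rfl⟩
  | cons t S ih =>
    obtain ⟨A, B, rfl⟩ := ih
    obtain ⟨e, a⟩ := t
    cases e
    · exact ⟨a ::ₘ A, B, by simp⟩
    · exact ⟨A, a ::ₘ B, by simp⟩

end Multisets

/-- Translation by `c` does not affect sums of `L` terms, because `Nat.card N` divides `L`. -/
theorem exists_sum_eq_zero_of_coset {N : Type*} [AddCommGroup N] [Finite N] [IsAddCyclic N]
    (K : AddSubgroup N) (c : N) (A : Multiset N) (hA : ∀ a ∈ A, a - c ∈ K) (L : ℕ)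
    (hd : Nat.card N ∣ L) (h : L + Nat.card K ≤ Multiset.card A + 1) :
    ∃ T ≤ A, Multiset.card T = L ∧ T.sum = 0 := by
  obtain ⟨T, hT, hTc, hTs⟩ := exists_zero_sum_of_addSubgroup K A (fun a => a - c) hA L
    ((AddSubgroup.card_addSubgroup_dvd_card K).trans hd) h
  refine ⟨T, hT, hTc, ?_⟩
  have hLc : L • c = 0 := by
    obtain ⟨j, rfl⟩ := hd
    rw [mul_comm, mul_smul, card_nsmul_eq_zero', smul_zero]
  rwa [Multiset.sum_map_sub, Multiset.map_id', Multiset.map_const', Multiset.sum_replicate, hTc,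
    hLc, sub_zero] at hTs

namespace Frame

variable {G N : Type*} [Group G] [AddCommGroup N] {F : Frame G N}

/-- From each pair in `N`, one term goes between the two given outside terms and the other after
them. Pairs of outside terms are placed after them as they are. -/
theorem ach_flatten_flip (b b' : N) (Q : Multiset ((Bool × N) × (Bool × N)))
    (hQ : ∀ q ∈ Q, q.1.1 = q.2.1) :
    F.Ach ({(true, b), (true, b')} + flatten Q)
      (F.σ b + b' + (Q.map fun q => F.σ q.1.2 + q.2.2).sum) := by
  obtain ⟨T, U, c, d, hTU, hT, hU, hcd⟩ : ∃ T U c d, flatten Q = T + U ∧ F.Ach T c ∧ F.Ach U d ∧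
      F.σ c + d = (Q.map fun q => F.σ q.1.2 + q.2.2).sum := by
    induction Q using Multiset.induction with
    | empty => exact ⟨0, 0, 0, 0, rfl, ach_zero, ach_zero, by simp⟩
    | cons q Q ih =>
      obtain ⟨T, U, c, d, hTU, hT, hU, hcd⟩ := ih fun q hq => hQ q (Multiset.mem_cons_of_mem hq)
      have h := hQ q (Multiset.mem_cons_self _ _)
      obtain ⟨⟨e, a⟩, ⟨e', a'⟩⟩ := q
      obtain rfl : e = e' := h
      cases e
      · refine ⟨_, _, _, _, ?_, (ach_single a).add hT, (ach_single a').add hU, ?_⟩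
        · rw [flatten_cons, hTU]
          simp only [Multiset.insert_eq_cons, ← Multiset.singleton_add]; abel
        · rw [Multiset.map_cons, Multiset.sum_cons, ← hcd, map_add]; abel
      · refine ⟨_, _, _, _, ?_, hT, (ach_pair a a').add hU, ?_⟩
        · rw [flatten_cons, hTU]; abel
        · rw [Multiset.map_cons, Multiset.sum_cons, ← hcd]; abel
  rw [hTU, ← hcd, ← add_assoc (F.σ b + b')]
  exact hT.flip b b' hU

/-! ### Odd order: Erdős–Ginzburg–Ziv applied to pairs. -/

section Odd

variable {m l : ℕ} {F : Frame G (ZMod m × ZMod l)}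

theorem card_comap_fst [NeZero m] (K : AddSubgroup (ZMod m)) :
    Nat.card (K.comap (AddMonoidHom.fst (ZMod m) (ZMod l))) = Nat.card K * l := by
  have h1 := AddSubgroup.card_mul_index (K.comap (AddMonoidHom.fst (ZMod m) (ZMod l)))
  have h2 := AddSubgroup.card_mul_index K
  rw [AddSubgroup.index_comap_of_surjective K Prod.fst_surjective, Nat.card_prod, ← h2,
    Nat.card_zmod] at h1
  have hpos : 0 < K.index := Nat.pos_of_ne_zero AddSubgroup.index_ne_zero_of_finite
  exact Nat.eq_of_mul_eq_mul_right hpos (by rw [h1]; ring)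

theorem card_comap_snd [NeZero l] (K : AddSubgroup (ZMod l)) :
    Nat.card (K.comap (AddMonoidHom.snd (ZMod m) (ZMod l))) = m * Nat.card K := by
  have h1 := AddSubgroup.card_mul_index (K.comap (AddMonoidHom.snd (ZMod m) (ZMod l)))
  have h2 := AddSubgroup.card_mul_index K
  rw [AddSubgroup.index_comap_of_surjective K Prod.snd_surjective, Nat.card_prod, ← h2,
    Nat.card_zmod] at h1
  have hpos : 0 < K.index := Nat.pos_of_ne_zero AddSubgroup.index_ne_zero_of_finite
  exact Nat.eq_of_mul_eq_mul_right hpos (by rw [h1]; ring)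

variable [NeZero m] [NeZero l] [IsAddCyclic (ZMod m × ZMod l)]

/-- The case of many terms outside of the cyclic subgroup. -/
theorem exists_ach_of_many (hσ : ∀ a, F.σ a = (-a.1, a.2)) (hm : 3 ≤ m) (hl : 3 ≤ l)
    (A B : Multiset (ZMod m × ZMod l))
    (hAB : Multiset.card A + Multiset.card B = 3 * (m * l))
    (hB : m + 2 * l ≤ Multiset.card B + 1) :
    ∃ T ≤ A.map (Prod.mk false) + B.map (Prod.mk true), Multiset.card T = 2 * (m * l) ∧
      F.Ach T 0 := by
  classical
  obtain ⟨R, hRB, hR, hRc⟩ := exists_pairing_card (Prod.fst : ZMod m × ZMod l → ZMod m) B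
  rw [Nat.card_zmod] at hRc
  obtain ⟨Q₁, hQ₁R, hQ₁c⟩ := exists_le_card (S := R) (k := l) (by omega)
  set S := A.map (Prod.mk false) + B.map (Prod.mk true) with hS
  set P₁ := Q₁.map (Prod.map (Prod.mk true) (Prod.mk true)) with hP₁
  have hP₁S : flatten P₁ ≤ S := by
    rw [hP₁, flatten_map]
    exact (Multiset.map_le_map ((flatten_mono hQ₁R).trans hRB)).trans (Multiset.le_add_left _ _)
  obtain ⟨P, hPS, hP, hPc⟩ := exists_pairing_card
    (fun t : Bool × (ZMod m × ZMod l) => (t.1, t.2.1)) (S - flatten P₁)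
  -- This is `(m - 2) * (l - 2) ≥ 1`.
  have hmul : m * l + 3 ≥ 2 * m + 2 * l := by
    obtain ⟨m', rfl⟩ := Nat.exists_eq_add_of_le hm
    obtain ⟨l', rfl⟩ := Nat.exists_eq_add_of_le hl
    ring_nf
    nlinarith [Nat.zero_le (m' * l')]
  have hP₁c : Multiset.card P₁ = l := by rw [hP₁, Multiset.card_map, hQ₁c]
  -- Only `m * l - 1` further pairs are kept, so that any `m * l` chosen pairs include one from
  -- `P₁`, whose outside terms enclose the rest.
  obtain ⟨P₂, hP₂P, hP₂c⟩ := exists_le_card (S := P) (k := m * l - 1) (by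
    rw [Multiset.card_sub hP₁S, card_flatten, hP₁c, hS] at hPc
    simp at hPc
    omega)
  have hP₂S : flatten P₁ + flatten P₂ ≤ S :=
    add_le_of_le_sub hP₁S ((flatten_mono hP₂P).trans hPS)
  have hcl : ∀ q ∈ P₁ + P₂, q.1.1 = q.2.1 ∧ q.1.2.1 = q.2.2.1 := by
    intro q hq
    rcases Multiset.mem_add.1 hq with hq | hq
    · obtain ⟨r, hr, rfl⟩ := Multiset.mem_map.1 hq
      exact ⟨rfl, hR r (Multiset.mem_of_le hQ₁R hr)⟩
    · simpa using hP q (Multiset.mem_of_le hP₂P hq)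
  have hcard := card_comap_fst (l := l) (⊥ : AddSubgroup (ZMod m))
  rw [AddSubgroup.card_bot, one_mul] at hcard
  obtain ⟨W, hW, hWc, hWs⟩ := exists_zero_sum_of_addSubgroup
    ((⊥ : AddSubgroup (ZMod m)).comap (AddMonoidHom.fst (ZMod m) (ZMod l))) (P₁ + P₂)
    (fun q => F.σ q.1.2 + q.2.2) (by
      intro q hq
      rw [AddSubgroup.mem_comap, AddSubgroup.mem_bot, hσ]
      simp [(hcl q hq).2]) (m * l)
    (by rw [hcard]; exact dvd_mul_left _ _)
    (by
      rw [hcard, Multiset.card_add, hP₁c, hP₂c]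
      have : 0 < m * l := by positivity
      omega)
  obtain ⟨W₁, hW₁, W₂, hW₂, rfl⟩ := exists_add_of_le_add hW
  have hpos : 0 < Multiset.card W₁ := by
    have h2 := Multiset.card_le_card hW₂
    rw [Multiset.card_add] at hWc
    have : 0 < m * l := by positivity
    omega
  obtain ⟨q, hq⟩ := Multiset.card_pos_iff_exists_mem.1 hpos
  obtain ⟨r, hr, rfl⟩ := Multiset.mem_map.1 (Multiset.mem_of_le hW₁ hq)
  refine ⟨flatten (W₁ + W₂), ?_, by rw [card_flatten, hWc], ?_⟩
  · rw [flatten_add]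
    exact (add_le_add (flatten_mono hW₁) (flatten_mono hW₂)).trans hP₂S
  · obtain ⟨V, rfl⟩ := Multiset.exists_cons_of_mem hq
    rw [Multiset.cons_add] at hW hWs ⊢
    rw [flatten_cons, ← hWs, Multiset.map_cons, Multiset.sum_cons]
    exact ach_flatten_flip r.1 r.2 (V + W₂) fun q hq =>
      (hcl q (Multiset.mem_of_le hW (Multiset.mem_cons_of_mem hq))).1

/-- The case where most terms of the cyclic subgroup lie in the subgroup `K × ZMod l`. -/
theorem exists_ach_of_addSubgroup (hσ : ∀ a, F.σ a = (-a.1, a.2)) (hm : 5 ≤ m) (hmo : Odd m)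
    (hl : 3 ≤ l) (A B : Multiset (ZMod m × ZMod l))
    (hAB : Multiset.card A + Multiset.card B = 3 * (m * l))
    (K : AddSubgroup (ZMod m)) (hK : Nat.card K < m) {A' : Multiset (ZMod m × ZMod l)}
    (hA' : A' ≤ A) (hA'K : ∀ a ∈ A', a.1 ∈ K)
    (hA'c : Multiset.card A + Nat.card K + 2 ≤ Multiset.card A' + l + m) :
    ∃ T ≤ A.map (Prod.mk false) + B.map (Prod.mk true), Multiset.card T = 2 * (m * l) ∧
      F.Ach T 0 := by
  classical
  obtain ⟨Q₁, hQ₁A, -, hQ₁c⟩ := exists_pairing_card (fun _ => ()) A'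
  obtain ⟨Q₂, hQ₂B, hQ₂, hQ₂c⟩ :=
    exists_pairing_card (fun b : ZMod m × ZMod l => (b.1 : ZMod m ⧸ K)) B
  set P := Q₁.map (Prod.map (Prod.mk false) (Prod.mk false)) +
    Q₂.map (Prod.map (Prod.mk true) (Prod.mk true)) with hP
  have hcard := card_comap_fst (l := l) K
  have hidx := AddSubgroup.card_mul_index K
  rw [Nat.card_zmod] at hidx
  have hPc : Multiset.card P = Multiset.card Q₁ + Multiset.card Q₂ := by simp [hP]
  obtain ⟨T, hT, hTc, hT0⟩ := exists_ach_of_pairs (F := F)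
    (K.comap (AddMonoidHom.fst (ZMod m) (ZMod l))) P (by
      intro q hq
      rcases Multiset.mem_add.1 hq with hq | hq <;>
      · obtain ⟨r, hr, rfl⟩ := Multiset.mem_map.1 hq
        rfl) (by
      intro q hq
      rcases Multiset.mem_add.1 hq with hq | hq
      · obtain ⟨r, hr, rfl⟩ := Multiset.mem_map.1 hq
        have h1 := hA'K _ (Multiset.mem_of_le hQ₁A (fst_mem_flatten hr))
        have h2 := hA'K _ (Multiset.mem_of_le hQ₁A (snd_mem_flatten hr))
        exact add_mem h1 h2
      · obtain ⟨r, hr, rfl⟩ := Multiset.mem_map.1 hq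
        have := QuotientAddGroup.eq.1 (hQ₂ r hr)
        simpa [val, hσ] using this) (m * l)
    (by rw [hcard]; exact Nat.mul_dvd_mul_right (Dvd.intro _ hidx) l)
    (by
      rw [hcard, hPc]
      simp only [Nat.card_eq_fintype_card, Fintype.card_unit] at hQ₁c
      have hi : Nat.card (ZMod m ⧸ K) = K.index := rfl
      rw [hi] at hQ₂c
      generalize Nat.card K = k at *
      generalize K.index = t at *
      have ht : 3 ≤ t := by
        by_contra h
        interval_cases t
        · omega
        · omega
        · rw [← hidx] at hmo
          exact absurd hmo (by simp)
      have hk : 1 ≤ k := by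
        rcases Nat.eq_zero_or_pos k with rfl | h
        · omega
        · exact h
      -- As `m` is odd and `K` proper, the index `t` is at least 3. For `m = 3` and trivial `K` the
      -- inequality fails, so `m ≥ 5` matters here.
      have key : l + m + t + 2 * (k * l) ≤ m * l + k + 4 := by
        subst hidx
        obtain ⟨t', rfl⟩ := Nat.exists_eq_add_of_le ht
        obtain ⟨l', rfl⟩ := Nat.exists_eq_add_of_le hl
        obtain ⟨k', rfl⟩ := Nat.exists_eq_add_of_le hk
        ring_nf at hm ⊢
        rcases Nat.eq_zero_or_pos t' with rfl | h
        · nlinarith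
        · nlinarith [Nat.zero_le (k' * l'), Nat.zero_le (t' * l'), Nat.zero_le (k' * t'),
            Nat.zero_le (k' * t' * l')]
      omega)
  refine ⟨T, hT.trans ?_, hTc, hT0⟩
  rw [hP, flatten_add, flatten_map, flatten_map]
  exact add_le_add (Multiset.map_le_map (hQ₁A.trans hA')) (Multiset.map_le_map hQ₂B)

end Odd

end Frame

/-! ### Odd order: few terms outside the cyclic subgroup. -/

namespace Frame

variable {G : Type*} [Group G]

section Odd

variable {m l : ℕ}

/-- The products of a sequence with terms outside of the cyclic subgroup. -/
theorem ach_of_subsetSums [NeZero m] {F : Frame G (ZMod m × ZMod l)}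
    (hσ : ∀ a, F.σ a = (-a.1, a.2)) (A B : Multiset (ZMod m × ZMod l))
    (hBe : Even (Multiset.card B)) (hB0 : B ≠ 0) (hs : (A.sum + B.sum).2 = 0)
    (hX : subsetSums (A.map fun a => -(a.1 + a.1)) = Finset.univ) :
    F.Ach (A.map (Prod.mk false) + B.map (Prod.mk true)) 0 := by
  obtain ⟨Q, rfl⟩ := exists_flatten_eq_of_even hBe
  obtain ⟨q, hq⟩ := Multiset.exists_mem_of_ne_zero (s := Q) (by rintro rfl; exact hB0 rfl)
  obtain ⟨P, rfl⟩ := Multiset.exists_cons_of_mem hq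
  set P' := P.map (Prod.map (Prod.mk true) (Prod.mk true)) with hP'
  have hPach : F.Ach ((flatten P).map (Prod.mk true)) (P'.map F.val).sum := by
    rw [← flatten_map]
    exact ach_flatten _ (by
      intro q hq
      obtain ⟨r, hr, rfl⟩ := Multiset.mem_map.1 hq
      rfl)
  have hPs : (P'.map F.val).sum.2 = (flatten P).sum.2 := by
    rw [hP', Multiset.map_map]
    clear hPach hP' P' hq hBe hB0 hs
    induction P using Multiset.induction with
    | empty => rfl
    | cons p P ih =>
      rw [flatten_cons, Multiset.map_cons, Multiset.sum_cons, Prod.snd_add, ih, Multiset.sum_add,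
        Prod.snd_add]
      simp [val, hσ]
  -- `D` consists of the terms to be enclosed by the outside pair `q`; it is chosen to cancel the
  -- first coordinate. The second coordinate does not depend on the ordering.
  obtain ⟨D, hD, hDs⟩ := mem_subsetSums_map.1
    (show -(F.σ q.1 + q.2 + A.sum + (P'.map F.val).sum).1 ∈
      subsetSums (A.map fun a => -(a.1 + a.1)) from hX ▸ Finset.mem_univ _)
  obtain ⟨E, rfl⟩ := Multiset.le_iff_exists_add.1 hD
  have h := Ach.flip q.1 q.2 (ach_map_false (F := F) D) ((ach_map_false (F := F) E).add hPach)
  convert h using 1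
  · rw [flatten_cons]
    simp only [Multiset.insert_eq_cons, ← Multiset.singleton_add, Multiset.map_add,
      Multiset.map_singleton]
    abel
  · have hDs' : (D.map fun a => -(a.1 + a.1)).sum = -(D.sum.1 + D.sum.1) := by
      have hfst : D.sum.1 = (D.map Prod.fst).sum :=
        map_multiset_sum (AddMonoidHom.fst (ZMod m) (ZMod l)) D
      rw [Multiset.sum_map_neg, Multiset.sum_map_add, hfst]
    rw [hDs'] at hDs
    rw [flatten_cons] at hs
    refine (Prod.ext ?_ ?_).symm
    · simp only [Prod.fst_add, Multiset.sum_add, hσ, Prod.fst_zero] at hDs ⊢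
      linear_combination hDs
    · simp [hσ, hPs] at hs ⊢
      linear_combination hs

/-- A sequence of length `2 l` which contains terms outside of the cyclic subgroup and whose
image in the abelianization sums to zero: the case of many terms outside. -/
theorem exists_block_of_many [NeZero l] (hl : 3 ≤ l) (A B : Multiset (ZMod m × ZMod l))
    (hA : 2 * l ≤ Multiset.card A) (hB : 2 * l ≤ Multiset.card B) :
    ∃ A₁ ≤ A, ∃ B₁ ≤ B, Multiset.card A₁ + Multiset.card B₁ = 2 * l ∧
      Even (Multiset.card B₁) ∧ B₁ ≠ 0 ∧ (A₁.sum + B₁.sum).2 = 0 := by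
  obtain ⟨Q, hQ, hQc⟩ := exists_flatten_le_of_card B l hB
  obtain ⟨P, hP, hPc⟩ := exists_flatten_le_of_card A (l - 1) (by omega)
  obtain ⟨W, hW, hWc, hWs⟩ := exists_zero_sum_of_addSubgroup (⊤ : AddSubgroup (ZMod l)) (Q + P)
    (fun q => (q.1 + q.2).2) (fun _ _ => trivial) l
    (by rw [AddSubgroup.card_top, Nat.card_zmod])
    (by rw [AddSubgroup.card_top, Nat.card_zmod, Multiset.card_add]; omega)
  obtain ⟨W₁, hW₁, W₂, hW₂, rfl⟩ := exists_add_of_le_add hW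
  -- Only `l - 1` pairs come from `A`, so one of the `l` chosen pairs comes from `B`.
  have hc1 : 0 < Multiset.card W₁ := by
    have := Multiset.card_le_card hW₂
    rw [Multiset.card_add] at hWc
    omega
  have hsum : ∀ V : Multiset ((ZMod m × ZMod l) × (ZMod m × ZMod l)),
      (flatten V).sum.2 = (V.map fun q => (q.1 + q.2).2).sum := by
    intro V
    have : (flatten V).sum = (V.map fun q => q.1 + q.2).sum := by
      rw [Multiset.sum_map_add, flatten, Multiset.sum_add]
    rw [this]
    exact (map_multiset_sum (AddMonoidHom.snd (ZMod m) (ZMod l)) _).trans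
      (by rw [Multiset.map_map]; rfl)
  refine ⟨flatten W₂, (flatten_mono hW₂).trans hP, flatten W₁, (flatten_mono hW₁).trans hQ,
    ?_, ?_, ?_, ?_⟩
  · rw [card_flatten, card_flatten]
    rw [Multiset.card_add] at hWc
    omega
  · rw [card_flatten]; exact even_two_mul _
  · intro h
    have := card_flatten W₁
    rw [h, Multiset.card_zero] at this
    omega
  · rw [Prod.snd_add, hsum, hsum, add_comm, ← Multiset.sum_add, ← Multiset.map_add, hWs]

variable [NeZero m] [NeZero l] [IsAddCyclic (ZMod m × ZMod l)]

/-- Disjoint pairs of terms of the cyclic subgroup with many different choice sums modulo `l`. -/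
theorem exists_pairs_card_le (hm : 5 ≤ m) (hl : 3 ≤ l) (hlo : Odd l)
    (A : Multiset (ZMod m × ZMod l)) (q : ℕ) (hq : q < 2 * l)
    (hA : Multiset.card A + q = 3 * (m * l))
    (hno : ¬ ∃ T ≤ A, Multiset.card T = 2 * (m * l) ∧ T.sum = 0) (r : ℕ) (hr : r < l) :
    ∃ Q : Multiset ((ZMod m × ZMod l) × (ZMod m × ZMod l)), flatten Q ≤ A ∧
      Multiset.card Q = r ∧
      min l (r + 1) ≤ (subsetSums (Q.map fun q => q.2.2 - q.1.2)).card := by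
  classical
  have hml : 5 * l ≤ m * l := Nat.mul_le_mul_right l hm
  induction r with
  | zero =>
    refine ⟨0, Multiset.zero_le _, rfl, ?_⟩
    have : 0 < (subsetSums ((0 : Multiset ((ZMod m × ZMod l) × (ZMod m × ZMod l))).map
        fun q => q.2.2 - q.1.2)).card := Finset.card_pos.2 ⟨0, zero_mem_subsetSums _⟩
    omega
  | succ r ih =>
    obtain ⟨Q, hQA, hQc, hQ⟩ := ih (by omega)
    set X := subsetSums (Q.map fun q => q.2.2 - q.1.2) with hX
    have hrest : Multiset.card (A - flatten Q) = Multiset.card A - 2 * r := by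
      rw [Multiset.card_sub hQA, card_flatten, hQc]
    obtain ⟨g, hg⟩ := Multiset.card_pos_iff_exists_mem.1
      (show 0 < Multiset.card (A - flatten Q) by omega)
    obtain ⟨R, hR⟩ := Multiset.exists_cons_of_mem hg
    have hRc : Multiset.card R + 1 = Multiset.card A - 2 * r := by
      rw [← hrest, hR, Multiset.card_cons]
    have hext : ∀ h ∈ R, flatten ((g, h) ::ₘ Q) ≤ A := by
      intro h hh
      rw [flatten_cons, add_comm]
      refine add_le_of_le_sub hQA ?_
      rw [hR, Multiset.insert_eq_cons, Multiset.cons_le_cons_iff]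
      exact Multiset.singleton_le.2 hh
    by_cases hfull : l ≤ X.card
    · obtain ⟨h, hh⟩ := Multiset.card_pos_iff_exists_mem.1 (show 0 < Multiset.card R by omega)
      refine ⟨(g, h) ::ₘ Q, hext h hh, by rw [Multiset.card_cons, hQc], ?_⟩
      refine (min_le_left _ _).trans (hfull.trans (Finset.card_le_card (subsetSums_mono ?_)))
      exact Multiset.map_le_map (Multiset.le_cons_self _ _)
    obtain ⟨z, hz⟩ : ∃ z, z ∉ X := by
      by_contra! h
      rw [Finset.eq_univ_of_forall h, Finset.card_univ, ZMod.card] at hfull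
      exact hfull le_rfl
    have hKX := card_periods_add_card_le hz
    rw [Nat.card_zmod] at hKX
    by_cases hgrow : ∃ h ∈ R, h.2 - g.2 ∉ periods X
    · obtain ⟨h, hh, hK⟩ := hgrow
      refine ⟨(g, h) ::ₘ Q, hext h hh, by rw [Multiset.card_cons, hQc], ?_⟩
      rw [Multiset.map_cons]
      refine le_trans ?_ (Nat.succ_le_of_lt (card_subsetSums_lt_cons hK))
      change _ ≤ X.card + 1
      omega
    -- If no pair containing `g` enlarges the sums, all remaining second coordinates lie in one
    -- coset of the periods, and EGZ in that coset contradicts `hno`.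
    · push Not at hgrow
      exfalso
      obtain ⟨T, hT, hTc, hT0⟩ := exists_sum_eq_zero_of_coset
        ((periods X).comap (AddMonoidHom.snd (ZMod m) (ZMod l))) g R hgrow (2 * (m * l))
        (by rw [Nat.card_prod, Nat.card_zmod, Nat.card_zmod]; exact dvd_mul_left _ _)
        (by
          rw [card_comap_snd]
          have hidx := AddSubgroup.card_mul_index (periods X)
          rw [Nat.card_zmod] at hidx
          have hXpos : 0 < X.card := Finset.card_pos.2 ⟨0, zero_mem_subsetSums _⟩
          generalize Nat.card (periods X) = k at *
          generalize (periods X).index = t at *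
          have ht : 3 ≤ t := by
            by_contra h
            interval_cases t
            · omega
            · omega
            · rw [← hidx] at hlo
              exact absurd hlo (by simp)
          -- With `l = k * t` and `t ≥ 3` this reads `m * (t - 1) ≥ 4 * t - 2`; for `t = 3` it says
          -- exactly `m ≥ 5`.
          have key : m * k + 4 * l ≤ m * l + 2 * k := by
            subst hidx
            obtain ⟨t', rfl⟩ := Nat.exists_eq_add_of_le ht
            obtain ⟨m', rfl⟩ := Nat.exists_eq_add_of_le hm
            ring_nf
            nlinarith [Nat.zero_le (k * t'), Nat.zero_le (k * m'), Nat.zero_le (k * t' * m')]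
          omega)
      exact hno ⟨T, hT.trans ((Multiset.le_cons_self _ _).trans (hR ▸ Multiset.sub_le_self _ _)),
        hTc, hT0⟩

/-- A sequence of length `2 l` which contains terms outside of the cyclic subgroup and whose
image in the abelianization sums to zero: the case of few terms outside. -/
theorem exists_block_of_few (hm : 5 ≤ m) (hl : 3 ≤ l) (hlo : Odd l)
    (A B : Multiset (ZMod m × ZMod l))
    (hAB : Multiset.card A + Multiset.card B = 3 * (m * l))
    (hB2 : 2 ≤ Multiset.card B) (hBl : Multiset.card B < 2 * l)
    (hno : ¬ ∃ T ≤ A, Multiset.card T = 2 * (m * l) ∧ T.sum = 0) :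
    ∃ A₁ ≤ A, ∃ B₁ ≤ B, Multiset.card A₁ + Multiset.card B₁ = 2 * l ∧
      Even (Multiset.card B₁) ∧ B₁ ≠ 0 ∧ (A₁.sum + B₁.sum).2 = 0 := by
  classical
  obtain ⟨Q, hQA, hQc, hQ⟩ := exists_pairs_card_le hm hl hlo A _ hBl hAB hno (l - 1) (by omega)
  obtain ⟨B₁, hB₁, hB₁c⟩ := exists_le_card hB2
  have hml : 5 * l ≤ m * l := Nat.mul_le_mul_right l hm
  -- One term of each of `l - 1` pairs, `l - 1` filler terms and two outside terms make length `2 *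
  -- l`.
  obtain ⟨E, hE, hEc⟩ := exists_le_card (S := A - flatten Q) (k := l - 1) (by
    rw [Multiset.card_sub hQA, card_flatten, hQc]; omega)
  have huniv : subsetSums (Q.map fun q => q.2.2 - q.1.2) = Finset.univ := by
    refine Finset.eq_univ_of_card _ (le_antisymm (Finset.card_le_univ _) ?_)
    rw [ZMod.card]
    omega
  have hmem : -((Q.map fun q => q.1.2).sum + E.sum.2 + B₁.sum.2) ∈
      subsetSums (Q.map fun q => q.2.2 - q.1.2) := huniv ▸ Finset.mem_univ _
  obtain ⟨T, hT, hTc, hTs⟩ := exists_choice_of_mem_subsetSums (φ := Prod.snd) hmem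
  have hTs' : T.sum.2 = (T.map Prod.snd).sum :=
    map_multiset_sum (AddMonoidHom.snd (ZMod m) (ZMod l)) T
  refine ⟨T + E, (add_le_add hT le_rfl).trans (add_le_of_le_sub hQA hE), B₁, hB₁, ?_, ?_, ?_, ?_⟩
  · rw [Multiset.card_add, hTc, hQc, hEc, hB₁c]; omega
  · rw [hB₁c]; exact even_two
  · rintro rfl; simp at hB₁c
  · rw [Multiset.sum_add, Prod.snd_add, Prod.snd_add, hTs', hTs]
    ring

variable {F : Frame G (ZMod m × ZMod l)}

/-- Enlarging a multiset of terms of the cyclic subgroup by blocks of length `l` with sum zero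
modulo `l`, so as to make the set of sums of twists grow. -/
theorem exists_extension (hσ : ∀ a, F.σ a = (-a.1, a.2)) (hm : 5 ≤ m) (hmo : Odd m) (hl : 3 ≤ l)
    (A B : Multiset (ZMod m × ZMod l))
    (hAB : Multiset.card A + Multiset.card B = 3 * (m * l))
    (hB : Multiset.card B + 2 ≤ m + 2 * l)
    (hno : ¬ ∃ T ≤ A.map (Prod.mk false) + B.map (Prod.mk true), Multiset.card T = 2 * (m * l) ∧
      F.Ach T 0)
    {A₁ : Multiset (ZMod m × ZMod l)} (hA₁ : A₁ ≤ A) (hA₁c : Multiset.card A₁ ≤ 2 * l)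
    (r : ℕ) (hr : r + 2 ≤ 2 * m) :
    ∃ A₂ ≤ A, Multiset.card A₂ = Multiset.card A₁ + r * l ∧ A₂.sum.2 = A₁.sum.2 ∧
      min m (r + 1) ≤ (subsetSums (A₂.map fun a => -(a.1 + a.1))).card := by
  classical
  induction r with
  | zero =>
    refine ⟨A₁, hA₁, by simp, rfl, ?_⟩
    have : 0 < (subsetSums (A₁.map fun a => -(a.1 + a.1))).card :=
      Finset.card_pos.2 ⟨0, zero_mem_subsetSums _⟩
    omega
  | succ r ih =>
    obtain ⟨A₂, hA₂, hA₂c, hA₂s, hX⟩ := ih (by omega)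
    set X := subsetSums (A₂.map fun a => -(a.1 + a.1)) with hXdef
    have hrest : 2 * l ≤ Multiset.card (A - A₂) + 1 := by
      rw [Multiset.card_sub hA₂, hA₂c]
      have h1 : r * l + 3 * l ≤ 2 * (m * l) := by
        have := Nat.mul_le_mul_right l (show r + 3 ≤ 2 * m by omega)
        nlinarith
      have h2 : m + 3 * l ≤ m * l + 3 := by
        obtain ⟨m', rfl⟩ := Nat.exists_eq_add_of_le hm
        obtain ⟨l', rfl⟩ := Nat.exists_eq_add_of_le hl
        ring_nf
        nlinarith [Nat.zero_le (m' * l')]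
      omega
    have hblock : ∀ U ≤ A - A₂, 2 * l ≤ Multiset.card U + 1 → ∃ W ≤ U, Multiset.card W = l ∧
        A₂ + W ≤ A ∧ Multiset.card (A₂ + W) = Multiset.card A₁ + (r + 1) * l ∧
        (A₂ + W).sum.2 = A₁.sum.2 := by
      intro U hU hUc
      obtain ⟨W, hW, hWc, hWs⟩ := exists_zero_sum_of_addSubgroup (⊤ : AddSubgroup (ZMod l)) U
        Prod.snd (fun _ _ => trivial) l (by rw [AddSubgroup.card_top, Nat.card_zmod])
        (by rw [AddSubgroup.card_top, Nat.card_zmod]; omega)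
      refine ⟨W, hW, hWc, add_le_of_le_sub hA₂ (hW.trans hU), ?_, ?_⟩
      · rw [Multiset.card_add, hA₂c, hWc]; ring
      · have : W.sum.2 = (W.map Prod.snd).sum :=
          map_multiset_sum (AddMonoidHom.snd (ZMod m) (ZMod l)) W
        rw [Multiset.sum_add, Prod.snd_add, hA₂s, this, hWs, add_zero]
    by_cases hfull : m ≤ X.card
    · obtain ⟨W, -, -, h1, h2, h3⟩ := hblock _ le_rfl hrest
      refine ⟨A₂ + W, h1, h2, h3, ?_⟩
      refine (min_le_left _ _).trans (hfull.trans (Finset.card_le_card (subsetSums_mono ?_)))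
      exact Multiset.map_le_map (Multiset.le_add_right _ _)
    obtain ⟨z, hz⟩ : ∃ z, z ∉ X := by
      by_contra! h
      rw [Finset.eq_univ_of_forall h, Finset.card_univ, ZMod.card] at hfull
      exact hfull le_rfl
    have hKX := card_periods_add_card_le hz
    rw [Nat.card_zmod] at hKX
    have hXpos : 0 < X.card := Finset.card_pos.2 ⟨0, zero_mem_subsetSums _⟩
    -- Doubling is invertible because `m` is odd.
    have hdouble : ∀ a : ZMod m, -(a + a) ∈ periods X → a ∈ periods X := by
      intro a ha
      obtain ⟨j, hj⟩ := hmo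
      have h1 : a = (j + 1) • (a + a) := by
        have : ((2 * j + 1 : ℕ) : ZMod m) = 0 := by rw [← hj, ZMod.natCast_self]
        push_cast at this
        rw [nsmul_eq_mul]
        push_cast
        linear_combination -a * this
      rw [h1]
      exact nsmul_mem (neg_mem_iff.1 ha) _
    set O := (A - A₂).filter (fun a => a.1 ∉ periods X) with hO
    by_cases hOc : l ≤ Multiset.card O
    · obtain ⟨O', hO', hO'c⟩ := exists_le_card hOc
      have hO'le : O' ≤ A - A₂ := hO'.trans (Multiset.filter_le _ _)
      -- EGZ selects `l` out of `l + (l - 1)` terms, hence at least one from `O'`, and that term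
      -- enlarges the sums.
      obtain ⟨R, hR, hRc⟩ := exists_le_card (S := A - A₂ - O') (k := l - 1)
        (by rw [Multiset.card_sub hO'le]; omega)
      obtain ⟨W, hW, hWc, h1, h2, h3⟩ := hblock (O' + R) (add_le_of_le_sub hO'le hR)
        (by rw [Multiset.card_add]; omega)
      obtain ⟨W₁, hW₁, W₂, hW₂, rfl⟩ := exists_add_of_le_add hW
      obtain ⟨a, ha⟩ := Multiset.card_pos_iff_exists_mem.1 (show 0 < Multiset.card W₁ by
        have := Multiset.card_le_card hW₂
        rw [Multiset.card_add] at hWc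
        omega)
      have haK : a.1 ∉ periods X :=
        (Multiset.mem_filter.1 (Multiset.mem_of_le (hW₁.trans hO') ha)).2
      refine ⟨_, h1, h2, h3, ?_⟩
      have hlt : X.card < (subsetSums (-(a.1 + a.1) ::ₘ A₂.map fun a => -(a.1 + a.1))).card :=
        card_subsetSums_lt_cons (fun h => haK (hdouble _ h))
      have hle := Finset.card_le_card (subsetSums_mono (Multiset.map_le_map
        (f := fun a : ZMod m × ZMod l => -(a.1 + a.1))
        (show a ::ₘ A₂ ≤ A₂ + (W₁ + W₂) by
          rw [← Multiset.singleton_add, add_comm]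
          exact add_le_add le_rfl ((Multiset.singleton_le.2 ha).trans
            (Multiset.le_add_right _ _)))))
      rw [Multiset.map_cons] at hle
      omega
    -- Fewer than `X.card ≤ m - Nat.card (periods X)` terms of `A₂` and fewer than `l` of the other
    -- terms of `A` have first coordinate outside `periods X`, which is the bound required by
    -- `exists_ach_of_addSubgroup`.
    · exfalso
      have hout : Multiset.card ((A₂.map fun a => -(a.1 + a.1)).filter (· ∉ periods X)) <
          X.card := by
        rw [hXdef]
        convert card_filter_lt_card_subsetSums (H := ZMod m) _ _ le_rfl
      rw [Multiset.filter_map, Multiset.card_map] at hout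
      have hA₂out : Multiset.card (A₂.filter (fun a => a.1 ∉ periods X)) < X.card := by
        refine lt_of_le_of_lt (Multiset.card_le_card (Multiset.monotone_filter_right _ ?_)) hout
        intro a ha h
        exact ha (hdouble _ h)
      have hsplit := Multiset.filter_add_not (fun a => a.1 ∈ periods X) A
      have hsplit' := congrArg Multiset.card hsplit
      rw [Multiset.card_add] at hsplit'
      have hAout : Multiset.card (A.filter (fun a => a.1 ∉ periods X)) =
          Multiset.card (A₂.filter (fun a => a.1 ∉ periods X)) + Multiset.card O := by
        rw [hO, ← Multiset.card_add, ← Multiset.filter_add, add_tsub_cancel_of_le hA₂]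
      exact hno (exists_ach_of_addSubgroup hσ hm hmo hl A B hAB (periods X) (by omega)
        (Multiset.filter_le (fun a => a.1 ∈ periods X) A)
        (fun a ha => (Multiset.mem_filter.1 ha).2) (by omega))

theorem exists_ach_two_mul (hσ : ∀ a, F.σ a = (-a.1, a.2)) (hm : 5 ≤ m) (hmo : Odd m)
    (hl : 3 ≤ l) (hlo : Odd l) (S : Multiset (Bool × (ZMod m × ZMod l)))
    (hS : Multiset.card S = 3 * (m * l)) :
    ∃ T ≤ S, Multiset.card T = 2 * (m * l) ∧ F.Ach T 0 := by
  classical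
  obtain ⟨A, B, rfl⟩ := exists_terms_eq S
  have hAB : Multiset.card A + Multiset.card B = 3 * (m * l) := by simpa using hS
  by_contra hno
  have hnoA : ¬ ∃ T ≤ A, Multiset.card T = 2 * (m * l) ∧ T.sum = 0 := by
    rintro ⟨T, hT, hTc, hT0⟩
    exact hno ⟨T.map (Prod.mk false), (Multiset.map_le_map hT).trans (Multiset.le_add_right _ _),
      by rw [Multiset.card_map, hTc], hT0 ▸ ach_map_false T⟩
  have hml : 5 * l ≤ m * l := Nat.mul_le_mul_right l hm
  have hml' : m * 3 ≤ m * l := Nat.mul_le_mul_left m hl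
  have hB2 : 2 ≤ Multiset.card B := by
    by_contra h
    have hN : Nat.card (ZMod m × ZMod l) = m * l := by
      rw [Nat.card_prod, Nat.card_zmod, Nat.card_zmod]
    exact hnoA (exists_sum_eq_zero_of_coset ⊤ 0 A (fun _ _ => trivial) (2 * (m * l))
      (by rw [hN]; exact dvd_mul_left _ _) (by rw [AddSubgroup.card_top, hN]; omega))
  have hBle : Multiset.card B + 2 ≤ m + 2 * l := by
    by_contra h
    exact hno (exists_ach_of_many hσ (by omega) hl A B hAB (by omega))
  obtain ⟨A₁, hA₁, B₁, hB₁, hc, hBe, hB0, hs⟩ : ∃ A₁ ≤ A, ∃ B₁ ≤ B,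
      Multiset.card A₁ + Multiset.card B₁ = 2 * l ∧
      Even (Multiset.card B₁) ∧ B₁ ≠ 0 ∧ (A₁.sum + B₁.sum).2 = 0 := by
    by_cases h : Multiset.card B < 2 * l
    · exact exists_block_of_few hm hl hlo A B hAB hB2 h hnoA
    · exact exists_block_of_many hl A B (by omega) (by omega)
  -- The number of blocks is dictated by the length `2 * (m * l)`; filling `ZMod m` would already
  -- take only `m - 1`.
  obtain ⟨A₂, hA₂, hA₂c, hA₂s, hX⟩ := exists_extension hσ hm hmo hl A B hAB hBle hno hA₁
    (by omega) (2 * m - 2) (by omega)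
  refine hno ⟨A₂.map (Prod.mk false) + B₁.map (Prod.mk true),
    add_le_add (Multiset.map_le_map hA₂) (Multiset.map_le_map hB₁), ?_, ?_⟩
  · rw [Multiset.card_add, Multiset.card_map, Multiset.card_map, hA₂c]
    have : (2 * m - 2) * l + 2 * l = 2 * (m * l) := by
      rw [← add_mul, show 2 * m - 2 + 2 = 2 * m by omega, mul_assoc]
    omega
  · refine ach_of_subsetSums hσ A₂ B₁ hBe hB0 ?_ ?_
    · rw [Prod.snd_add, hA₂s, ← Prod.snd_add, hs]
    · refine Finset.eq_univ_of_card _ (le_antisymm (Finset.card_le_univ _) ?_)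
      rw [ZMod.card]
      omega

end Odd

end Frame

/-- A threshold holds from `L` on exactly if it holds at `L` and fails for a multiset of
cardinality `L - 1`. -/
theorem sInf_threshold_eq {G : Type*} {P : Multiset G → Prop} {L : ℕ}
    (hup : ∀ S, L + 1 ≤ Multiset.card S → P S) {W : Multiset G} (hW : Multiset.card W = L)
    (hPW : ¬ P W) : sInf {l | 0 < l ∧ ∀ S, l ≤ Multiset.card S → P S} = L + 1 := by
  have hmem : L + 1 ∈ {l | 0 < l ∧ ∀ S, l ≤ Multiset.card S → P S} := ⟨Nat.succ_pos _, hup⟩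
  refine le_antisymm (Nat.sInf_le hmem) (le_csInf ⟨_, hmem⟩ ?_)
  rintro l ⟨-, hl⟩
  by_contra h
  exact hPW (hl W (by omega))

/-! ### The four constants from a product-one free sequence. -/

section Constants

variable {G : Type*} [Group G]

theorem IsProductOne.of_cons_one {T : Multiset G} (h : IsProductOne (1 ::ₘ T)) :
    IsProductOne T := by
  obtain ⟨l, hl, hp⟩ := h
  have hmem : (1 : G) ∈ l := by
    rw [← Multiset.mem_coe, hl]
    exact Multiset.mem_cons_self _ _
  obtain ⟨u, v, rfl⟩ := List.mem_iff_append.1 hmem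
  refine ⟨u ++ v, ?_, by simpa using hp⟩
  rw [← Multiset.coe_add, ← Multiset.cons_coe, Multiset.add_cons] at hl
  rw [← Multiset.coe_add]
  exact (Multiset.cons_inj_right _).1 hl

theorem IsProductOne.of_add_replicate_one {T : Multiset G} {j : ℕ}
    (h : IsProductOne (T + Multiset.replicate j 1)) : IsProductOne T := by
  induction j with
  | zero => simpa using h
  | succ j ih =>
    rw [Multiset.replicate_succ, Multiset.add_cons] at h
    exact ih h.of_cons_one

theorem IsProductOne.add {T U : Multiset G} (hT : IsProductOne T) (hU : IsProductOne U) :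
    IsProductOne (T + U) := by
  obtain ⟨l, rfl, hl⟩ := hT
  obtain ⟨k, rfl, hk⟩ := hU
  exact ⟨l ++ k, by simp, by rw [List.prod_append, hl, hk, one_mul]⟩

theorem exists_short_of_add_replicate_one {S : Multiset G} {e : ℕ} (he : 0 < e)
    (h : HasProductOneSub e (S + Multiset.replicate (e - 1) 1)) :
    ∃ T ≤ S, 1 ≤ Multiset.card T ∧ Multiset.card T ≤ e ∧ IsProductOne T := by
  obtain ⟨T, hT, hTc, hT1⟩ := h
  obtain ⟨T₁, hT₁, T₂, hT₂, rfl⟩ := exists_add_of_le_add hT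
  obtain ⟨j, hj, rfl⟩ := Multiset.le_replicate_iff.1 hT₂
  rw [Multiset.card_add, Multiset.card_replicate] at hTc
  exact ⟨T₁, hT₁, by omega, by omega, hT1.of_add_replicate_one⟩

section FreeSequence

variable {W : Multiset G} {e : ℕ}

/-- Sharpness comes from `W` padded with `e - 1` ones: a product-one subsequence of length `e`
would, after removal of its ones, leave a nonempty one inside `W`. -/
theorem sInf_productOne_eq (hW : IsProductOneFree W) (he : 0 < e)
    (hup : ∀ S : Multiset G, Multiset.card W + e ≤ Multiset.card S → HasProductOneSub e S) :
    sInf {l | 0 < l ∧ ∀ S : Multiset G, l ≤ Multiset.card S → HasProductOneSub e S} =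
      Multiset.card W + e := by
  have h := sInf_threshold_eq (P := HasProductOneSub (G := G) e)
    (L := Multiset.card W + (e - 1)) (fun S hS => hup S (by omega))
    (W := W + Multiset.replicate (e - 1) 1) (by simp) (by
      intro h
      obtain ⟨T, hT, hT1, -, hTp⟩ := exists_short_of_add_replicate_one he h
      exact hW T hT hT1 hTp)
  rw [h]
  omega

/-- The upper bound is applied to `S` padded with ones. Taking `e` to be the exponent yields `η`,
taking `e = Nat.card G` yields the Davenport constant. -/
theorem exists_short_of_card_lt (he : 0 < e)
    (hup : ∀ S : Multiset G, Multiset.card W + e ≤ Multiset.card S → HasProductOneSub e S)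
    (S : Multiset G) (hS : Multiset.card W + 1 ≤ Multiset.card S) :
    ∃ T ≤ S, 1 ≤ Multiset.card T ∧ Multiset.card T ≤ e ∧ IsProductOne T :=
  exists_short_of_add_replicate_one he (hup _ (by simp; omega))

/-- If the bounds for product-one subsequences of lengths `|G|` and `exp G` are as good as a
product-one free sequence `W` allows, then all four constants are determined by `W`. -/
theorem constants_eq_of_isProductOneFree [Finite G] (hW : IsProductOneFree W)
    (hgao : ∀ S : Multiset G, Multiset.card W + Nat.card G ≤ Multiset.card S →
      HasProductOneSub (Nat.card G) S)
    (hegz : ∀ S : Multiset G, Multiset.card W + Monoid.exponent G ≤ Multiset.card S →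
      HasProductOneSub (Monoid.exponent G) S) :
    gaoConstant G = Multiset.card W + Nat.card G ∧
      egzConstant G = Multiset.card W + Monoid.exponent G ∧
      etaConstant G = Multiset.card W + 1 ∧ smallDavenport G = Multiset.card W := by
  have hexp : 0 < Monoid.exponent G :=
    Nat.pos_of_ne_zero Monoid.exponent_ne_zero_of_finite
  refine ⟨sInf_productOne_eq hW Nat.card_pos hgao, sInf_productOne_eq hW hexp hegz, ?_, ?_⟩
  · refine sInf_threshold_eq (P := HasShortProductOneSub (G := G))
      (fun S hS => exists_short_of_card_lt hexp hegz S hS) rfl ?_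
    rintro ⟨T, hT, hT1, -, hTp⟩
    exact hW T hT hT1 hTp
  · refine IsGreatest.csSup_eq ⟨⟨W, rfl, hW⟩, ?_⟩
    rintro k ⟨S, rfl, hS⟩
    by_contra h
    obtain ⟨T, hT, hT1, -, hTp⟩ := exists_short_of_card_lt Nat.card_pos hgao S (by omega)
    exact hS T hT hT1 hTp

end FreeSequence

end Constants

namespace Frame

variable {G N : Type*} [Group G] [AddCommGroup N]

theorem hasProductOneSub {F : Frame G N} (hF : Function.Surjective F.ev) {k L : ℕ}
    (h : ∀ S : Multiset (Bool × N), Multiset.card S = L →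
      ∃ T ≤ S, Multiset.card T = k ∧ F.Ach T 0)
    (S : Multiset G) (hS : L ≤ Multiset.card S) : HasProductOneSub k S := by
  obtain ⟨S₀, hS₀, hS₀c⟩ := exists_le_card hS
  have hmap : (S₀.map (Function.surjInv hF)).map F.ev = S₀ := by
    rw [Multiset.map_map]
    simp [Function.surjInv_eq hF]
  obtain ⟨T, hT, hTc, hT0⟩ := h (S₀.map (Function.surjInv hF)) (by simpa using hS₀c)
  refine ⟨T.map F.ev, ?_, by simpa using hTc, hT0.isProductOne⟩
  rw [← hmap] at hS₀
  exact (Multiset.map_le_map hT).trans hS₀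

/-- Transport of a frame along an isomorphism. -/
def comap {N' : Type*} [AddCommGroup N'] (F : Frame G N) (e : N' ≃+ N) (σ' : N' →+ N')
    (h : ∀ a, e (σ' a) = F.σ (e a)) : Frame G N' where
  y a := F.y (e a)
  x := F.x
  σ := σ'
  y_add a b := by rw [map_add, F.y_add]
  x_mul_x := F.x_mul_x
  y_mul_x a := by rw [F.y_mul_x, h]
  σ_σ a := e.injective (by rw [h, h, F.σ_σ])

theorem comap_ev_surjective {N' : Type*} [AddCommGroup N'] {F : Frame G N} {e : N' ≃+ N}
    {σ' : N' →+ N'} {h : ∀ a, e (σ' a) = F.σ (e a)} (hF : Function.Surjective F.ev) :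
    Function.Surjective (F.comap e σ' h).ev := by
  intro g
  obtain ⟨⟨b, a⟩, rfl⟩ := hF g
  refine ⟨(b, e.symm a), ?_⟩
  cases b <;> simp [ev, comap]

end Frame

/-! ### The presented group: normal form, order, exponent. -/

namespace Gns

variable {n : ℕ} {s : ℤ}

/-- The generator `x`. -/
def x (n : ℕ) (s : ℤ) : Gns n s := PresentedGroup.of Gen.x

/-- The generator `y`. -/
def y (n : ℕ) (s : ℤ) : Gns n s := PresentedGroup.of Gen.y

theorem x_mul_x : x n s * x n s = 1 := by
  have h : FreeGroup.of Gen.x ^ 2 ∈ rels n s := by simp [rels]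
  have := PresentedGroup.one_of_mem h
  rwa [map_pow, pow_two] at this

theorem y_pow : y n s ^ n = 1 := by
  have h : FreeGroup.of Gen.y ^ n ∈ rels n s := by simp [rels]
  have := PresentedGroup.one_of_mem h
  rwa [map_pow] at this

theorem y_mul_x : y n s * x n s = x n s * y n s ^ s := by
  have h : (FreeGroup.of Gen.y * FreeGroup.of Gen.x) *
     (FreeGroup.of Gen.x * FreeGroup.of Gen.y ^ s)⁻¹ ∈ rels n s := by simp [rels]
  have := PresentedGroup.one_of_mem h
  rw [map_mul, map_inv, map_mul, map_mul, map_zpow, mul_inv_eq_one] at this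
  exact this

theorem y_zpow_mul_x (k : ℤ) : y n s ^ k * x n s = x n s * y n s ^ (s * k) := by
  have h : (x n s)⁻¹ * y n s * (x n s)⁻¹⁻¹ = y n s ^ s := by
    rw [inv_inv, mul_assoc, y_mul_x, inv_mul_cancel_left]
  rw [zpow_mul, ← h, conj_zpow, inv_inv]
  group

/-- The homomorphism `a ↦ y ^ a` from `ZMod n`, written additively. -/
def yHom (n : ℕ) (s : ℤ) : ZMod n →+ Additive (Gns n s) :=
  ZMod.lift n ⟨zmultiplesHom _ (Additive.ofMul (y n s)), by
    rw [zmultiplesHom_apply, natCast_zsmul, ← ofMul_pow, y_pow, ofMul_one]⟩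

theorem yHom_intCast (k : ℤ) : (yHom n s k).toMul = y n s ^ k := by
  rw [yHom, ZMod.lift_coe]
  rfl

theorem intCast_mul_self (hs : s ^ 2 ≡ 1 [ZMOD n]) : (s : ZMod n) * s = 1 := by
  have := (ZMod.intCast_eq_intCast_iff _ _ _).2 hs
  push_cast at this
  rw [← this, pow_two]

/-- The normal form `x ^ e * y ^ a` of the elements of `Gns n s`. -/
def frame (hs : s ^ 2 ≡ 1 [ZMOD n]) : Frame (Gns n s) (ZMod n) where
  y a := (yHom n s a).toMul
  x := x n s
  σ := AddMonoidHom.mulLeft (s : ZMod n)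
  y_add a b := by rw [map_add, toMul_add]
  x_mul_x := x_mul_x
  y_mul_x a := by
    obtain ⟨k, rfl⟩ := ZMod.intCast_surjective a
    change _ = x n s * (yHom n s ((s : ZMod n) * (k : ZMod n))).toMul
    rw [← Int.cast_mul, yHom_intCast, yHom_intCast, y_zpow_mul_x]
  σ_σ a := by
    change (s : ZMod n) * (s * a) = a
    rw [← mul_assoc, intCast_mul_self hs, one_mul]

theorem frame_σ (hs : s ^ 2 ≡ 1 [ZMOD n]) (a : ZMod n) : (frame hs).σ a = s * a := rfl

theorem frame_y_one (hs : s ^ 2 ≡ 1 [ZMOD n]) : (frame hs).y 1 = y n s := by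
  have := yHom_intCast (n := n) (s := s) 1
  rw [Int.cast_one, zpow_one] at this
  exact this

theorem frame_y_natCast (hs : s ^ 2 ≡ 1 [ZMOD n]) (k : ℕ) : (frame hs).y k = y n s ^ k := by
  have := yHom_intCast (n := n) (s := s) k
  rw [Int.cast_natCast, zpow_natCast] at this
  exact this

theorem frame_ev_mul (hs : s ^ 2 ≡ 1 [ZMOD n]) (t u : Bool × ZMod n) :
    ∃ v, (frame hs).ev v = (frame hs).ev t * (frame hs).ev u := by
  obtain ⟨e, a⟩ := t
  obtain ⟨f, b⟩ := u
  have hy := (frame hs).y_add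
  cases e <;> cases f
  · exact ⟨(false, a + b), by simp [hy]⟩
  · refine ⟨(true, (frame hs).σ a + b), ?_⟩
    rw [Frame.ev_true, Frame.ev_true, Frame.ev_false, hy, ← mul_assoc, ← mul_assoc,
      (frame hs).y_mul_x]
  · exact ⟨(true, a + b), by simp [hy, mul_assoc]⟩
  · refine ⟨(false, (frame hs).σ a + b), ?_⟩
    rw [Frame.ev_true, Frame.ev_true, Frame.ev_false, hy, mul_assoc, ← mul_assoc ((frame hs).y a),
      (frame hs).y_mul_x, ← mul_assoc, ← mul_assoc, (frame hs).x_mul_x, one_mul]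

theorem frame_ev_surjective (hs : s ^ 2 ≡ 1 [ZMOD n]) : Function.Surjective (frame hs).ev := by
  intro g
  have hg : g ∈ Subgroup.closure (Set.range (PresentedGroup.of (rels := rels n s))) := by
    rw [PresentedGroup.closure_range_of]; trivial
  have hx : (frame hs).ev (true, 0) = x n s := by
    rw [Frame.ev_true, Frame.y_zero, mul_one]; rfl
  have hy : (frame hs).ev (false, 1) = y n s := frame_y_one hs
  induction hg using Subgroup.closure_induction with
  | mem g hg =>
    obtain ⟨i, rfl⟩ := hg
    cases i
    · exact ⟨_, hx⟩
    · exact ⟨_, hy⟩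
  | one => exact ⟨(false, 0), (frame hs).y_zero⟩
  | mul g h _ _ ihg ihh =>
    obtain ⟨t, rfl⟩ := ihg
    obtain ⟨u, rfl⟩ := ihh
    exact frame_ev_mul hs t u
  | inv g _ ih =>
    obtain ⟨⟨e, a⟩, rfl⟩ := ih
    have hyn : ((frame hs).y a)⁻¹ = (frame hs).y (-a) := by
      rw [inv_eq_iff_mul_eq_one, ← (frame hs).y_add, add_neg_cancel, (frame hs).y_zero]
    cases e
    · exact ⟨(false, -a), hyn.symm⟩
    · have hxi : (frame hs).x⁻¹ = (frame hs).x := inv_eq_of_mul_eq_one_left (frame hs).x_mul_x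
      refine ⟨(true, (frame hs).σ (-a)), ?_⟩
      rw [Frame.ev_true, Frame.ev_true, mul_inv_rev, hyn, hxi, (frame hs).y_mul_x]

/-- The homomorphism to `C₂` with kernel generated by `y`. -/
def sign (n : ℕ) (s : ℤ) : Gns n s →* Multiplicative (ZMod 2) :=
  PresentedGroup.toGroup
    (f := fun i => match i with
      | Gen.x => Multiplicative.ofAdd 1
      | Gen.y => 1) (by
    intro r hr
    simp only [rels, Set.mem_insert_iff, Set.mem_singleton_iff] at hr
    rcases hr with rfl | rfl | rfl
    · simp only [map_pow, FreeGroup.lift_apply_of]; rfl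
    · simp
    · simp)

theorem sign_x : sign n s (x n s) = Multiplicative.ofAdd 1 := PresentedGroup.toGroup.of _

theorem sign_y : sign n s (y n s) = 1 := PresentedGroup.toGroup.of _

/-- Translations of an additive group. -/
def translation (A : Type*) [AddGroup A] : Multiplicative A →* Equiv.Perm A where
  toFun a := Equiv.addLeft a.toAdd
  map_one' := by ext; simp
  map_mul' a b := by ext; simp

/-- The images of the generators under `perm`. -/
def genPerm (hs : s ^ 2 ≡ 1 [ZMOD n]) : Gen → Equiv.Perm (ZMod n)
  | Gen.x =>
    { toFun := fun a => s * a
      invFun := fun a => s * a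
      left_inv := fun a => by simp only [← mul_assoc, intCast_mul_self hs, one_mul]
      right_inv := fun a => by simp only [← mul_assoc, intCast_mul_self hs, one_mul] }
  | Gen.y => translation (ZMod n) (Multiplicative.ofAdd 1)

theorem genPerm_x_apply (hs : s ^ 2 ≡ 1 [ZMOD n]) (a : ZMod n) :
    genPerm hs Gen.x a = s * a := rfl

theorem genPerm_y (hs : s ^ 2 ≡ 1 [ZMOD n]) :
    genPerm hs Gen.y = translation (ZMod n) (Multiplicative.ofAdd 1) := rfl

/-- The action of `Gns n s` on `ZMod n` for which `y` is translation by `1` and `x` is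
multiplication by `s`. -/
def perm (hs : s ^ 2 ≡ 1 [ZMOD n]) : Gns n s →* Equiv.Perm (ZMod n) :=
  PresentedGroup.toGroup
    (f := genPerm hs) (by
    intro r hr
    simp only [rels, Set.mem_insert_iff, Set.mem_singleton_iff] at hr
    rcases hr with rfl | rfl | rfl
    · simp only [map_pow, FreeGroup.lift_apply_of]
      ext a
      rw [pow_two, Equiv.Perm.mul_apply, genPerm_x_apply, genPerm_x_apply, ← mul_assoc,
        intCast_mul_self hs, one_mul, Equiv.Perm.one_apply]
    · simp only [map_pow, FreeGroup.lift_apply_of]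
      rw [genPerm_y, ← map_pow, ← ofAdd_nsmul]
      simp
    · rw [map_mul, map_inv, mul_inv_eq_one]
      simp only [map_mul, map_zpow, FreeGroup.lift_apply_of]
      rw [genPerm_y, ← map_zpow, ← ofAdd_zsmul]
      ext a
      rw [Equiv.Perm.mul_apply, Equiv.Perm.mul_apply, genPerm_x_apply, genPerm_x_apply]
      simp [translation, mul_add, intCast_mul_self hs])

theorem perm_y_apply (hs : s ^ 2 ≡ 1 [ZMOD n]) (a b : ZMod n) :
    perm hs ((frame hs).y a) b = a + b := by
  obtain ⟨k, rfl⟩ := ZMod.intCast_surjective a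
  have h1 : perm hs (y n s) = translation (ZMod n) (Multiplicative.ofAdd 1) :=
    PresentedGroup.toGroup.of _
  have h2 : (frame hs).y k = y n s ^ k := yHom_intCast k
  rw [h2, map_zpow, h1, ← map_zpow, ← ofAdd_zsmul]
  simp [translation]

theorem sign_frame_y (hs : s ^ 2 ≡ 1 [ZMOD n]) (a : ZMod n) : sign n s ((frame hs).y a) = 1 := by
  obtain ⟨k, rfl⟩ := ZMod.intCast_surjective a
  have h2 : (frame hs).y k = y n s ^ k := yHom_intCast k
  rw [h2, map_zpow, sign_y, one_zpow]

theorem frame_y_injective (hs : s ^ 2 ≡ 1 [ZMOD n]) : Function.Injective (frame hs).y := by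
  intro a b h
  have := congrArg (fun g => perm hs g 0) h
  simpa [perm_y_apply] using this

theorem frame_ev_injective (hs : s ^ 2 ≡ 1 [ZMOD n]) : Function.Injective (frame hs).ev := by
  have hsx : sign n s (frame hs).x = Multiplicative.ofAdd 1 := sign_x
  have hne : (Multiplicative.ofAdd (1 : ZMod 2)) ≠ 1 := by decide
  rintro ⟨e, a⟩ ⟨f, b⟩ h
  have h1 := congrArg (sign n s) h
  cases e <;> cases f
  · exact congrArg _ (frame_y_injective hs h)
  · rw [Frame.ev_true, Frame.ev_false, map_mul, sign_frame_y, sign_frame_y, hsx, mul_one] at h1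
    exact absurd h1.symm hne
  · rw [Frame.ev_true, Frame.ev_false, map_mul, sign_frame_y, sign_frame_y, hsx, mul_one] at h1
    exact absurd h1 hne
  · exact congrArg _ (frame_y_injective hs (mul_left_cancel h))

theorem card_eq (hs : s ^ 2 ≡ 1 [ZMOD n]) : Nat.card (Gns n s) = 2 * n := by
  rw [← Nat.card_congr (Equiv.ofBijective _ ⟨frame_ev_injective hs, frame_ev_surjective hs⟩),
    Nat.card_prod, Nat.card_zmod]
  simp

theorem orderOf_y (hs : s ^ 2 ≡ 1 [ZMOD n]) : orderOf (y n s) = n := by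
  refine Nat.dvd_antisymm (orderOf_dvd_of_pow_eq_one y_pow) ?_
  have h := pow_orderOf_eq_one (y n s)
  rw [← frame_y_natCast hs, ← (frame hs).y_zero] at h
  exact (ZMod.natCast_eq_zero_iff _ _).1 (frame_y_injective hs h)

theorem orderOf_x : orderOf (x n s) = 2 := by
  refine orderOf_eq_prime (by rw [pow_two, x_mul_x]) fun h => ?_
  have := sign_x (n := n) (s := s)
  rw [h, map_one] at this
  exact absurd this (by decide)

theorem exponent_of_odd (hs : s ^ 2 ≡ 1 [ZMOD n]) (hn : Odd n) :
    Monoid.exponent (Gns n s) = 2 * n := by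
  refine Nat.dvd_antisymm (card_eq hs ▸ Group.exponent_dvd_nat_card) ?_
  refine Nat.Coprime.mul_dvd_of_dvd_of_dvd hn.coprime_two_left ?_ ?_
  · rw [← orderOf_x (n := n) (s := s)]; exact Monoid.order_dvd_exponent _
  · conv_lhs => rw [← orderOf_y hs]
    exact Monoid.order_dvd_exponent _

theorem odd_of_even (hs : s ^ 2 ≡ 1 [ZMOD n]) (hn : Even n) : Odd s := by
  have h2 : (2 : ℤ) ∣ s ^ 2 - 1 :=
    (by exact_mod_cast hn.two_dvd : (2 : ℤ) ∣ n).trans hs.symm.dvd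
  rw [← Int.not_even_iff_odd]
  intro h
  have h3 : Even (s ^ 2) := h.pow_of_ne_zero two_ne_zero
  have h4 := h3.two_dvd
  omega

theorem exponent_of_even (hs : s ^ 2 ≡ 1 [ZMOD n]) (hn : Even n) :
    Monoid.exponent (Gns n s) = n := by
  refine Nat.dvd_antisymm (Monoid.exponent_dvd_of_forall_pow_eq_one fun g => ?_) ?_
  · obtain ⟨⟨e, a⟩, rfl⟩ := frame_ev_surjective hs g
    have hpow : ∀ (b : ZMod n) (k : ℕ), (frame hs).y b ^ k = (frame hs).y (k * b) := by
      intro b k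
      induction k with
      | zero => simp [(frame hs).y_zero]
      | succ k ih => rw [pow_succ, ih, ← (frame hs).y_add]; congr 1; push_cast; ring
    cases e
    · rw [Frame.ev_false, hpow, ZMod.natCast_self, zero_mul, (frame hs).y_zero]
    · obtain ⟨k, hk⟩ := hn
      obtain ⟨j, hj⟩ := odd_of_even hs ⟨k, hk⟩
      -- The square is `y ^ ((s + 1) * a)`, and `s + 1` is even, so its power `n / 2` is trivial.
      have hsq : (frame hs).ev (true, a) ^ 2 = (frame hs).y (s * a + a) := by
        rw [Frame.ev_true, pow_two, mul_assoc, ← mul_assoc ((frame hs).y a), (frame hs).y_mul_x,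
          ← mul_assoc, ← mul_assoc, (frame hs).x_mul_x, one_mul, ← (frame hs).y_add]
        rfl
      have hn2 : n = 2 * k := by omega
      have hz : ((2 * k : ℕ) : ZMod n) = 0 := by rw [← hn2, ZMod.natCast_self]
      refine (congrArg ((frame hs).ev (true, a) ^ ·) hn2).trans ?_
      change (frame hs).ev (true, a) ^ (2 * k) = 1
      rw [pow_mul, hsq, hpow, ← (frame hs).y_zero]
      congr 1
      rw [hj]
      push_cast at hz ⊢
      linear_combination (j + 1 : ZMod n) * a * hz
  · conv_lhs => rw [← orderOf_y hs]
    exact Monoid.order_dvd_exponent _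

/-- A subsequence containing `x` has nontrivial sign; one without `x` is a power of `y` with
exponent between `1` and `n - 1`. -/
theorem isProductOneFree (hs : s ^ 2 ≡ 1 [ZMOD n]) :
    IsProductOneFree (x n s ::ₘ Multiset.replicate (n - 1) (y n s)) := by
  intro T hT hT1 hTp
  rcases le_cons_cases hT with hT | ⟨T', hT', rfl⟩
  · obtain ⟨j, hj, rfl⟩ := Multiset.le_replicate_iff.1 hT
    rw [Multiset.card_replicate] at hT1
    obtain ⟨l, hl, hp⟩ := hTp
    have hl' : l = List.replicate j (y n s) := by
      rw [List.eq_replicate_iff]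
      have hc := congrArg Multiset.card hl
      rw [Multiset.coe_card, Multiset.card_replicate] at hc
      refine ⟨hc, fun b hb => ?_⟩
      rw [← Multiset.mem_coe, hl] at hb
      exact Multiset.eq_of_mem_replicate hb
    rw [hl', List.prod_replicate] at hp
    have := orderOf_dvd_of_pow_eq_one hp
    rw [orderOf_y hs] at this
    have := Nat.le_of_dvd hT1 this
    omega
  · obtain ⟨j, hj, rfl⟩ := Multiset.le_replicate_iff.1 hT'
    obtain ⟨l, hl, hp⟩ := hTp
    have h1 := congrArg (sign n s) hp
    rw [map_list_prod, map_one, ← Multiset.prod_coe, ← Multiset.map_coe, hl, Multiset.map_cons,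
      Multiset.map_replicate, sign_x, sign_y, Multiset.prod_cons, Multiset.prod_replicate, one_pow,
      mul_one] at h1
    exact absurd h1 (by decide)

theorem hasProductOneSub_of_even (hs : s ^ 2 ≡ 1 [ZMOD n]) (hs1 : ¬ s ≡ 1 [ZMOD n])
    (hn0 : 0 < n) (hn : Even n) (S : Multiset (Gns n s)) (hS : 2 * n ≤ Multiset.card S) :
    HasProductOneSub n S := by
  have : NeZero n := ⟨hn0.ne'⟩
  refine Frame.hasProductOneSub (frame_ev_surjective hs) (fun S' hS' => ?_) S hS
  have key := Frame.exists_ach_card (F := frame hs)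
    (par := (ZMod.castHom hn.two_dvd (ZMod 2)).toAddMonoidHom)
    (by
      intro a
      have h1 : ((s : ℤ) : ZMod 2) = 1 := by
        obtain ⟨j, rfl⟩ := odd_of_even hs hn
        have : (2 : ZMod 2) = 0 := rfl
        push_cast
        rw [this, zero_mul, zero_add]
      rw [frame_σ]
      change ZMod.castHom hn.two_dvd (ZMod 2) _ = ZMod.castHom hn.two_dvd (ZMod 2) _
      rw [map_mul, map_intCast, h1, one_mul])
    (ZMod.castHom_surjective hn.two_dvd)
    ⟨1, by
      rw [frame_σ, mul_one]
      intro h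
      apply hs1
      rw [← ZMod.intCast_eq_intCast_iff, h, Int.cast_one]⟩ S' (by rw [hS', Nat.card_zmod])
  rwa [Nat.card_zmod] at key

/-- The factors are the greatest common divisors of `n` with `s + 1` and `s - 1`. Their product is
divisible by `n`, which divides `(s + 1) * (s - 1)`. A common divisor divides both 2 and the odd
number `n`, so they are coprime. Neither is 1, since `s` is not `±1` modulo `n`. -/
theorem exists_isFactorization (hs : s ^ 2 ≡ 1 [ZMOD n]) (hs1 : ¬ s ≡ 1 [ZMOD n])
    (hs2 : ¬ s ≡ -1 [ZMOD n]) (hn : Odd n) : ∃ n₁ n₂, IsFactorization n s n₁ n₂ := by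
  have hd1 : n.gcd (s + 1).natAbs ∣ n := Nat.gcd_dvd_left _ _
  have hd2 : n.gcd (s - 1).natAbs ∣ n := Nat.gcd_dvd_left _ _
  have hp1 : ((n.gcd (s + 1).natAbs : ℕ) : ℤ) ∣ s + 1 :=
    Int.natCast_dvd.2 (Nat.gcd_dvd_right _ _)
  have hp2 : ((n.gcd (s - 1).natAbs : ℕ) : ℤ) ∣ s - 1 :=
    Int.natCast_dvd.2 (Nat.gcd_dvd_right _ _)
  have hdvd : n ∣ n.gcd (s + 1).natAbs * n.gcd (s - 1).natAbs := by
    rw [Nat.dvd_gcd_mul_gcd_iff_dvd_mul, ← Int.natAbs_mul, ← Int.natCast_dvd]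
    have := hs.symm.dvd
    rwa [show s ^ 2 - 1 = (s + 1) * (s - 1) by ring] at this
  generalize n.gcd (s + 1).natAbs = n₁ at *
  generalize n.gcd (s - 1).natAbs = n₂ at *
  have hcop : Nat.Coprime n₁ n₂ := by
    have h2 : ((n₁.gcd n₂ : ℕ) : ℤ) ∣ 2 := by
      have h1 := (Int.natCast_dvd_natCast.2 (Nat.gcd_dvd_left n₁ n₂)).trans hp1
      have h3 := (Int.natCast_dvd_natCast.2 (Nat.gcd_dvd_right n₁ n₂)).trans hp2
      have := dvd_sub h1 h3
      rwa [show s + 1 - (s - 1) = 2 by ring] at this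
    have h3 : n₁.gcd n₂ ∣ 2 := by exact_mod_cast h2
    have h4 : n₁.gcd n₂ ∣ n := (Nat.gcd_dvd_left _ _).trans hd1
    exact Nat.eq_one_of_dvd_coprimes hn.coprime_two_left h3 h4
  have hmul : n = n₁ * n₂ := Nat.dvd_antisymm hdvd (hcop.mul_dvd_of_dvd_of_dvd hd1 hd2)
  have hm1 : s ≡ -1 [ZMOD n₁] := by
    refine (Int.modEq_iff_dvd.2 ?_).symm
    rwa [sub_neg_eq_add]
  have hm2 : s ≡ 1 [ZMOD n₂] := (Int.modEq_iff_dvd.2 hp2).symm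
  rw [hmul] at hn
  obtain ⟨ho1, ho2⟩ := Nat.odd_mul.1 hn
  refine ⟨n₁, n₂, hmul, hcop, ?_, ?_, hm1, hm2⟩
  · by_contra h
    have h1 : n₁ = 1 := by
      obtain ⟨j, rfl⟩ := ho1
      omega
    rw [h1, one_mul] at hmul
    exact hs1 (hmul ▸ hm2)
  · by_contra h
    have h1 : n₂ = 1 := by
      obtain ⟨j, rfl⟩ := ho2
      omega
    rw [h1, mul_one] at hmul
    exact hs2 (hmul ▸ hm1)

theorem hasProductOneSub_of_odd {n₁ n₂ : ℕ} (hs : s ^ 2 ≡ 1 [ZMOD n]) (hn : Odd n)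
    (hfac : IsFactorization n s n₁ n₂) (h3 : 3 < n₁) (S : Multiset (Gns n s))
    (hS : 3 * n ≤ Multiset.card S) : HasProductOneSub (2 * n) S := by
  obtain ⟨rfl, hcop, -, hn₂, hm1, hm2⟩ := hfac
  obtain ⟨ho1, ho2⟩ := Nat.odd_mul.1 hn
  have h5 : 5 ≤ n₁ := by
    obtain ⟨j, rfl⟩ := ho1
    omega
  have : NeZero n₁ := ⟨by omega⟩
  have : NeZero n₂ := ⟨by omega⟩
  let e := (ZMod.chineseRemainder hcop).toAddEquiv
  have hcyc : IsAddCyclic (ZMod n₁ × ZMod n₂) := isAddCyclic_of_surjective e e.surjective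
  let σ' : ZMod n₁ × ZMod n₂ →+ ZMod n₁ × ZMod n₂ :=
    AddMonoidHom.prodMap (-AddMonoidHom.id _) (AddMonoidHom.id _)
  have hσ' : ∀ a, e.symm (σ' a) = (frame hs).σ (e.symm a) := by
    intro a
    have hse : ZMod.chineseRemainder hcop (s : ZMod (n₁ * n₂)) = (-1, 1) := by
      rw [map_intCast]
      refine Prod.ext ?_ ?_
      · have := (ZMod.intCast_eq_intCast_iff _ _ _).2 hm1
        rw [Prod.fst_intCast, this]
        simp
      · have := (ZMod.intCast_eq_intCast_iff _ _ _).2 hm2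
        rw [Prod.snd_intCast, this]
        simp
    apply e.injective
    rw [e.apply_symm_apply, frame_σ]
    change _ = ZMod.chineseRemainder hcop _
    rw [map_mul, hse]
    change _ = (-1, 1) * e (e.symm a)
    rw [e.apply_symm_apply]
    refine Prod.ext ?_ ?_ <;> simp [σ']
  refine Frame.hasProductOneSub (F := (frame hs).comap e.symm σ' hσ')
    (Frame.comap_ev_surjective (frame_ev_surjective hs)) (fun S' hS' => ?_) S hS
  exact Frame.exists_ach_two_mul (fun a => rfl) h5 ho1 hn₂ ho2 S' hS'

end Gns

end ZeroSum

/-! ### The main theorem. -/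

theorem theorem1p4 (n : ℕ) (s : ℤ) (hn : 8 ≤ n)
    (hs : s ^ 2 ≡ 1 [ZMOD (n : ℤ)])
    (hs1 : ¬ s ≡ 1 [ZMOD (n : ℤ)])
    (hs2 : ¬ s ≡ -1 [ZMOD (n : ℤ)])
    (hodd : Odd n → ∀ n₁ n₂ : ℕ, ZeroSum.IsFactorization n s n₁ n₂ → 3 < n₁) :
    ZeroSum.gaoConstant (ZeroSum.Gns n s) = 3 * n ∧
    ZeroSum.egzConstant (ZeroSum.Gns n s) = (if Even n then 2 * n else 3 * n) ∧
    ZeroSum.egzConstant (ZeroSum.Gns n s) =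
      ZeroSum.etaConstant (ZeroSum.Gns n s) + Monoid.exponent (ZeroSum.Gns n s) - 1 ∧
    ZeroSum.gaoConstant (ZeroSum.Gns n s) =
      ZeroSum.smallDavenport (ZeroSum.Gns n s) + Nat.card (ZeroSum.Gns n s) := by
  have hcard := ZeroSum.Gns.card_eq hs
  have : Finite (ZeroSum.Gns n s) := Nat.finite_of_card_ne_zero (by omega)
  have hfree := ZeroSum.Gns.isProductOneFree hs
  have hWc : Multiset.card (ZeroSum.Gns.x n s ::ₘ Multiset.replicate (n - 1) (ZeroSum.Gns.y n s))
      = n := by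
    rw [Multiset.card_cons, Multiset.card_replicate]; omega
  by_cases he : Even n
  · have hexp := ZeroSum.Gns.exponent_of_even hs he
    have hup := ZeroSum.Gns.hasProductOneSub_of_even hs hs1 (by omega) he
    obtain ⟨h1, h2, h3, h4⟩ := ZeroSum.constants_eq_of_isProductOneFree hfree
      (by
        classical
        rw [hWc, hcard]
        intro S hS
        -- Of `3 * n` terms, `2 * n` are left after removing a first product-one subsequence of
        -- length `n`, so a second one exists; together they have length `2 * n`.
        obtain ⟨T, hT, hTc, hT1⟩ := hup S (by omega)
        obtain ⟨U, hU, hUc, hU1⟩ := hup (S - T) (by rw [Multiset.card_sub hT]; omega)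
        exact ⟨T + U, ZeroSum.add_le_of_le_sub hT hU, by rw [Multiset.card_add]; omega,
          hT1.add hU1⟩)
      (by
        rw [hWc, hexp]
        exact fun S hS => hup S (by omega))
    rw [h1, h2, h3, h4, hWc, hexp, hcard, if_pos he]
    omega
  · have ho : Odd n := Nat.not_even_iff_odd.1 he
    have hexp := ZeroSum.Gns.exponent_of_odd hs ho
    obtain ⟨n₁, n₂, hfac⟩ := ZeroSum.Gns.exists_isFactorization hs hs1 hs2 ho
    have hup := ZeroSum.Gns.hasProductOneSub_of_odd hs ho hfac (hodd ho n₁ n₂ hfac)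
    obtain ⟨h1, h2, h3, h4⟩ := ZeroSum.constants_eq_of_isProductOneFree hfree
      (by
        rw [hWc, hcard]
        exact fun S hS => hup S (by omega))
      (by
        rw [hWc, hexp]
        exact fun S hS => hup S (by omega))
    rw [h1, h2, h3, h4, hWc, hexp, hcard, if_neg he]
    omega
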